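/- For $x=(x_1,x_2)\in\mathbb{R}^2$ write $x^\perp=(-x_2,x_1)$ and let $K(x)=\frac{1}{2\pi}\frac{x^\perp}{|x|^2}$ be the Biot–Savart kernel. Let $\mathcal{M}$ be the space of finite signed Borel measures on $\mathbb{R}^2$; for $\omega\in\mathcal{M}$ let $|\omega|$ be its variation, $\|\omega\|_{\mathcal{M}}=|\omega|(\mathbb{R}^2)$, and define the vorticity maximal function $$M_r(\omega)=\sup_{x\in\mathbb{R}^2}|\omega|\big(\overline{B}_r(x)\big),\qquad \overline{B}_r(x)=\{y:|y-x|\le r\}.$$ Let $\omega\in H^{-1}_{\mathrm{loc}}(\mathbb{R}^2)\cap\mathcal{M}$ (that is, $\omega\in\mathcal{M}$ and $\varphi\omega\in H^{-1}(\mathbb{R}^2)$ for every $\varphi\in C_c^\infty(\mathbb{R}^2)$), and let $u=K*\omega$, i.e. $u(x)=\int_{\mathbb{R}^2}K(x-y)\,d\omega(y)$ for a.e. $x$ (the integral converges absolutely for a.e. $x$). Let $C\in\mathbb{R}$ and $\beta>0$. Then for every $r>0$ such that $$M_s(\omega)\le C s^\beta\qquad\text{for all } 0<s\le r,$$ we have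 $$\frac{1}{|B_r(0)|}\int_{B_r(0)}\int_{\mathbb{R}^2}|u(x+h)-u(x)|^2\,dx\,dh\;\le\;\frac{C}{\beta}\,\|\omega\|_{\mathcal{M}}\,r^\beta .$$ In particular, if $M_s(\omega)\le Cs^\beta$ for all $s>0$, the last bound holds for all $r>0$. -/

import Mathlib

open MeasureTheory
open scoped ENNReal

noncomputable section

namespace VortexSheet

/-- The Euclidean plane `ℝ²`. -/
abbrev Plane : Type := EuclideanSpace ℝ (Fin 2)

/-- The Biot-Savart kernel `K(x) = (2π)⁻¹ x^⊥ / |x|²`, with `x^⊥ = (-x₂, x₁)`.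
(The value at the origin is `0`.) -/
def biotSavartKernel (x : Plane) : Plane :=
  (1 / (2 * Real.pi) * (1 / ‖x‖ ^ 2)) • !₂[-x 1, x 0]

/-- The velocity `(K ∗ ω)(x) = ∫ K(x - y) dω(y)` induced by a vorticity `ω`. The integral is that
of a plane-valued function against a finite signed measure; it is `0` at the points `x` at which
`y ↦ K(x - y)` is not `|ω|`-integrable. -/
def biotSavart (ω : SignedMeasure Plane) (x : Plane) : Plane :=
  ∫ᵛ y, biotSavartKernel (x - y) ∂<•ω

/-- The total variation norm `‖ω‖_𝓜 = |ω|(ℝ²)`. -/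
def totalVariationNorm (ω : SignedMeasure Plane) : ℝ≥0∞ :=
  ω.variation Set.univ

/-- The vorticity maximal function `M_r(ω) = sup_x |ω|(closed ball of radius r around x)`. -/
def vorticityMaximal (ω : SignedMeasure Plane) (r : ℝ) : ℝ≥0∞ :=
  ⨆ x : Plane, ω.variation (Metric.closedBall x r)

/-- A finite signed measure `ω`, seen as the tempered distribution `φ ↦ ∫ φ dω = ∫ φ dω⁺ - ∫ φ dω⁻`,
where `ω = ω⁺ - ω⁻` is the Jordan decomposition. -/
def toDistribution (ω : SignedMeasure Plane) : TemperedDistribution Plane ℂ :=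
  ω.toJordanDecomposition.posPart.toTemperedDistribution
    - ω.toJordanDecomposition.negPart.toTemperedDistribution

/-- `ω ∈ H⁻¹_loc(ℝ²)`: for every smooth compactly supported `φ` the distribution `φ ω` belongs to
the Sobolev space `H⁻¹(ℝ²)`. -/
def MemHNegOneLoc (ω : SignedMeasure Plane) : Prop :=
  ∀ φ : Plane → ℂ, ContDiff ℝ (⊤ : ℕ∞) φ → HasCompactSupport φ →
    TemperedDistribution.MemSobolev (-1) 2
      (TemperedDistribution.smulLeftCLM ℂ φ (toDistribution ω))

/-- The squared structure function: the average over `h` in the open ball `B_r(0)` of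
`∫ |u(x + h) - u(x)|² dx`, as a value in `[0, ∞]`. -/
def structureFunctionSq (u : Plane → Plane) (r : ℝ) : ℝ≥0∞ :=
  (volume (Metric.ball (0 : Plane) r))⁻¹ *
    ∫⁻ h in Metric.ball (0 : Plane) r, ∫⁻ x : Plane, ‖u (x + h) - u x‖ₑ ^ 2

end VortexSheet

end

open MeasureTheory
open scoped ENNReal

noncomputable section

namespace VortexSheet

/-! Write `ω = σμ` with `μ = |ω|` and `|σ| ≤ 1`. Expanding the square, `|u(x+h) - u(x)|² =
(|u(x+h)|² - |u(x)|²) + 2 u(x)·(u(x) - u(x+h))`. By translation invariance the first bracket should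
integrate to zero in `x`, and averaging over `h` then leaves `2 ∫ u·v`, where `v` is `u` minus its
mean over balls of radius `r`.

For the kernel this difference is explicit and supported in a ball: it is `max(0, 1 - |x|²/r²) K(x)`
(`setIntegral_ball_biotSavartKernel`). Hence `∫ u·v` is a double integral against `μ ⊗ μ` of
correlations of `K` with the local kernel. Polar coordinates around the pole of the local kernel and
Cauchy's theorem on circles bound each correlation by `(2π)⁻¹ ∫ ds/s` over `|y - z| < s ≤ r`
(`enorm_integral_inner_localKernel_le`). Tonelli turns the `μ`-integral of this into `∫₀^r μ(B_s(y))
ds/s`, at most `C r^β/β` (`lintegral_lintegral_Ioc_rpow_le`). This yields the estimate with an extra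
factor `1/π`, which is dropped.

The cancellation by translation is only formal, since `u` may decay no faster than `1/|x|` and so
miss `L²` of the plane. It is carried out with the weight `N/(N+|x|)`; the resulting error is at
most a multiple of `∫ |u|²/(N+|x|)`, which tends to zero because `|u|²/(1+|x|)` is integrable, and
Fatou's lemma removes the weight (`lintegral_increment_le`). The integrability facts come from
splitting `1/|x|` into a local and a far part. -/

/-! ### Angular integrals of `w/(w - z)` over circles. -/

open Real in
theorem intervalIntegral_circleMap_div_sub {ρ : ℝ} (hρ : 0 < ρ) {z : ℂ} (hz : ‖z‖ ≠ ρ) :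
    ∫ θ in (0 : ℝ)..2 * π, circleMap 0 ρ θ / (circleMap 0 ρ θ - z) =
      if ‖z‖ < ρ then 2 * (π : ℂ) else 0 := by
  -- On the circle `dw = i w dθ`, so this is the Cauchy integral of `1/(w - z)`: `2πi` for `z`
  -- inside, zero for `z` outside.
  have key : ∮ w in C(0, ρ), (w - z)⁻¹ =
      Complex.I * ∫ θ in (0 : ℝ)..2 * π, circleMap 0 ρ θ / (circleMap 0 ρ θ - z) := by
    rw [circleIntegral, ← intervalIntegral.integral_const_mul]
    congr 1 with θ
    simp only [deriv_circleMap, smul_eq_mul]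
    ring
  have hI : ∫ θ in (0 : ℝ)..2 * π, circleMap 0 ρ θ / (circleMap 0 ρ θ - z) =
      -Complex.I * ∮ w in C(0, ρ), (w - z)⁻¹ := by
    rw [key, ← mul_assoc]; simp
  rw [hI]
  split_ifs with h
  · rw [circleIntegral.integral_sub_inv_of_mem_ball (by simpa using h)]
    linear_combination (-2 * (π : ℂ)) * Complex.I_sq
  · have hz' : ρ < ‖z‖ := lt_of_le_of_ne (not_lt.1 h) (Ne.symm hz)
    have hne : ∀ w ∈ Metric.closedBall (0 : ℂ) ρ, w - z ≠ 0 := by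
      intro w hw h0
      rw [sub_eq_zero] at h0
      subst h0
      simp at hw
      linarith
    rw [Complex.circleIntegral_eq_zero_of_differentiable_on_off_countable hρ.le
      Set.countable_empty, mul_zero]
    · exact ContinuousOn.inv₀ (by fun_prop) hne
    · intro w hw
      have := hne w (Metric.ball_subset_closedBall hw.1)
      fun_prop (disch := assumption)

open Real in
theorem setIntegral_Ioo_circle_div_sub {ρ : ℝ} (hρ : 0 < ρ) {z : ℂ} (hz : ‖z‖ ≠ ρ) :
    ∫ θ in Set.Ioo (-π) π, (ρ * (Real.cos θ + Real.sin θ * Complex.I) : ℂ) /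
        (ρ * (Real.cos θ + Real.sin θ * Complex.I) - z) =
      if ‖z‖ < ρ then 2 * (π : ℂ) else 0 := by
  rw [← intervalIntegral_circleMap_div_sub hρ hz, ← integral_Ioc_eq_integral_Ioo,
    ← intervalIntegral.integral_of_le (by linarith [pi_pos])]
  have hper : Function.Periodic (fun θ => circleMap 0 ρ θ / (circleMap 0 ρ θ - z)) (2 * π) := by
    intro θ
    simp only [periodic_circleMap 0 ρ θ]
  have := hper.intervalIntegral_add_eq (-π) 0
  rw [zero_add, show -π + 2 * π = π by ring] at this
  rw [← this]
  congr 1 with θ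
  simp [circleMap, Complex.exp_mul_I]

/-! ### The kernel in complex coordinates. -/

/-- The isometry `ℂ ≃ ℝ²`. -/
def complexEquiv : ℂ ≃ₗᵢ[ℝ] Plane := Complex.orthonormalBasisOneI.repr

theorem measurePreserving_complexEquiv : MeasurePreserving complexEquiv :=
  complexEquiv.measurePreserving

theorem measurableEmbedding_complexEquiv : MeasurableEmbedding complexEquiv :=
  complexEquiv.toHomeomorph.measurableEmbedding

theorem complexEquiv_apply (w : ℂ) : complexEquiv w = !₂[w.re, w.im] := by
  ext i
  fin_cases i <;> simp [complexEquiv]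

theorem norm_biotSavartKernel (x : Plane) :
    ‖biotSavartKernel x‖ = 1 / (2 * Real.pi) * ‖x‖⁻¹ := by
  have h : ‖(!₂[-x 1, x 0] : Plane)‖ = ‖x‖ := by
    simp [EuclideanSpace.norm_eq, Fin.sum_univ_two, add_comm]
  rw [biotSavartKernel, norm_smul, h, Real.norm_of_nonneg (by positivity)]
  rcases eq_or_ne ‖x‖ 0 with h0 | h0
  · simp [h0]
  · field_simp

theorem norm_biotSavartKernel_le (x : Plane) : ‖biotSavartKernel x‖ ≤ ‖x‖⁻¹ := by
  rw [norm_biotSavartKernel]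
  have : 1 / (2 * Real.pi) ≤ 1 := by
    rw [div_le_one (by positivity)]; linarith [Real.pi_gt_three]
  exact mul_le_of_le_one_left (by positivity) this

theorem biotSavartKernel_neg (x : Plane) : biotSavartKernel (-x) = -biotSavartKernel x := by
  ext i
  fin_cases i <;> simp [biotSavartKernel]

@[fun_prop]
theorem measurable_biotSavartKernel : Measurable biotSavartKernel := by
  unfold biotSavartKernel
  have hc : Measurable fun x : Plane => 1 / (2 * Real.pi) * (1 / ‖x‖ ^ 2) := by fun_prop
  refine hc.smul (Continuous.measurable ?_)
  refine (PiLp.continuous_toLp 2 _).comp ?_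
  refine continuous_pi fun i => ?_
  fin_cases i <;> simp <;> fun_prop

/-- Rotation by a right angle is multiplication by `i`, and `w/|w|²` is the conjugate of `w⁻¹`. Thus
`K` is a real-linear image of `w⁻¹`, which makes complex analysis available. -/
theorem biotSavartKernel_complexEquiv (w : ℂ) :
    biotSavartKernel (complexEquiv w) =
      complexEquiv (1 / (2 * Real.pi) * Complex.I * (starRingEnd ℂ) w⁻¹) := by
  have : biotSavartKernel (complexEquiv w) =
      complexEquiv ((1 / (2 * Real.pi) * (1 / ‖w‖ ^ 2) : ℝ) • (Complex.I * w)) := by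
    rw [map_smul, biotSavartKernel, complexEquiv.norm_map]
    congr 1
    ext i
    fin_cases i <;> simp [complexEquiv_apply]
  rw [this, Complex.real_smul, Complex.inv_def, _root_.map_mul (starRingEnd ℂ), Complex.conj_conj,
    Complex.conj_ofReal, Complex.normSq_eq_norm_sq]
  push_cast
  congr 1
  ring

theorem inner_complexEquiv (w z : ℂ) :
    inner ℝ (complexEquiv w) (complexEquiv z) = ((starRingEnd ℂ) w * z).re := by
  rw [complexEquiv.inner_map_map, Complex.inner, mul_comm]

/-! ### Polar coordinates and local integrability of powers of the norm. -/

theorem integral_eq_integral_polar {E : Type*} [NormedAddCommGroup E] [NormedSpace ℝ E]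
    {f : ℂ → E} (hm : StronglyMeasurable f) (hf : Integrable f) :
    ∫ w, f w = ∫ ρ in Set.Ioi (0 : ℝ), ∫ θ in Set.Ioo (-Real.pi) Real.pi,
      ρ • f (ρ * (Real.cos θ + Real.sin θ * Complex.I)) := by
  rw [← Complex.integral_comp_polarCoord_symm]
  have htarget : polarCoord.target = Set.Ioi (0 : ℝ) ×ˢ Set.Ioo (-Real.pi) Real.pi := rfl
  have hint : IntegrableOn (fun p : ℝ × ℝ => p.1 • f (Complex.polarCoord.symm p))
      (Set.Ioi (0 : ℝ) ×ˢ Set.Ioo (-Real.pi) Real.pi) (volume.prod volume) := by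
    refine ⟨?_, ?_⟩
    · have hpm : Measurable fun p : ℝ × ℝ => Complex.polarCoord.symm p := by
        simp only [Complex.polarCoord_symm_apply]
        fun_prop
      exact (measurable_fst.stronglyMeasurable.smul
        (hm.comp_measurable hpm)).aestronglyMeasurable
    · have h := hf.2
      rw [HasFiniteIntegral, ← Complex.lintegral_comp_polarCoord_symm, htarget] at h
      rw [HasFiniteIntegral]
      refine lt_of_le_of_lt (le_of_eq ?_) h
      refine setLIntegral_congr_fun (measurableSet_Ioi.prod measurableSet_Ioo) fun p hp => ?_
      simp only [enorm_smul, smul_eq_mul]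
      rw [Real.enorm_of_nonneg (le_of_lt hp.1)]
  rw [htarget, Measure.volume_eq_prod, setIntegral_prod _ hint]
  simp only [Complex.polarCoord_symm_apply]

theorem integrableOn_ball_norm_rpow {E : Type*} [NormedAddCommGroup E] [NormedSpace ℝ E]
    [FiniteDimensional ℝ E] [MeasureSpace E] [BorelSpace E]
    [Measure.IsAddHaarMeasure (volume : Measure E)]
    (hE : Module.finrank ℝ E = 2) {s : ℝ} (hs : -2 < s) (r : ℝ) :
    IntegrableOn (fun x : E => ‖x‖ ^ s) (Metric.ball 0 r) := by
  have : Nontrivial E := Module.nontrivial_of_finrank_pos (R := ℝ) (by omega)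
  refine (integrableOn_fun_norm_addHaar volume (f := fun y : ℝ => y ^ s)).2 ?_
  rcases le_or_gt r 0 with hr | hr
  · simp [Set.Ioo_eq_empty_of_le hr]
  have h := (intervalIntegral.integrableOn_Ioo_rpow_iff (s := s + 1) hr).2 (by linarith)
  refine h.congr_fun (fun y hy => ?_) measurableSet_Ioo
  simp [hE, Real.rpow_add_one hy.1.ne', mul_comm]

theorem integrableOn_ball_norm_inv {E : Type*} [NormedAddCommGroup E] [NormedSpace ℝ E]
    [FiniteDimensional ℝ E] [MeasureSpace E] [BorelSpace E]
    [Measure.IsAddHaarMeasure (volume : Measure E)]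
    (hE : Module.finrank ℝ E = 2) (r : ℝ) :
    IntegrableOn (fun x : E => ‖x‖⁻¹) (Metric.ball 0 r) := by
  simpa [Real.rpow_neg_one] using integrableOn_ball_norm_rpow hE (s := -1) (by norm_num) r

theorem integrableOn_ball_norm_add_inv {E : Type*} [NormedAddCommGroup E] [NormedSpace ℝ E]
    [FiniteDimensional ℝ E] [MeasureSpace E] [BorelSpace E]
    [Measure.IsAddHaarMeasure (volume : Measure E)]
    (hE : Module.finrank ℝ E = 2) (a : E) (r : ℝ) :
    IntegrableOn (fun x : E => ‖a + x‖⁻¹) (Metric.ball 0 r) := by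
  have h := (integrableOn_ball_norm_inv hE (‖a‖ + r)).integrable_indicator measurableSet_ball
  refine (h.comp_add_left a).integrableOn.congr_fun (s := Metric.ball 0 r) (fun x hx => ?_)
    measurableSet_ball
  refine Set.indicator_of_mem ?_ _
  simp at hx ⊢
  linarith [norm_add_le a x]

/-! ### The kernel averaged over balls. -/

theorem norm_ofReal_mul_cos_add_sin (ρ θ : ℝ) :
    ‖(ρ * (Real.cos θ + Real.sin θ * Complex.I) : ℂ)‖ = |ρ| := by
  rw [← Complex.norm_polarCoord_symm (ρ, θ), Complex.polarCoord_symm_apply]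

open Real in
theorem integrableOn_circle_div_sub {ρ : ℝ} (hρ : 0 < ρ) {z : ℂ} (hz : ‖z‖ ≠ ρ) :
    IntegrableOn (fun θ : ℝ => (ρ * (Real.cos θ + Real.sin θ * Complex.I) : ℂ) /
        (ρ * (Real.cos θ + Real.sin θ * Complex.I) - z)) (Set.Ioo (-π) π) := by
  refine IntegrableOn.mono_set (t := Set.Icc (-π) π) ?_ Set.Ioo_subset_Icc_self
  refine ContinuousOn.integrableOn_Icc ?_
  refine ContinuousOn.div (by fun_prop) (by fun_prop) fun θ _ h0 => ?_
  apply hz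
  have hn := norm_ofReal_mul_cos_add_sin ρ θ
  rwa [abs_of_pos hρ, sub_eq_zero.1 h0] at hn

-- Since `(a + w)⁻¹ = a⁻¹ (1 - w/(w + a))`, the mean over the circle of radius `ρ` is `a⁻¹` for `ρ <
-- ‖a‖` and zero for `ρ > ‖a‖`. Only the disc of radius `min r ‖a‖` contributes.
open Real in
theorem setIntegral_ball_inv {a : ℂ} (ha : a ≠ 0) {r : ℝ} (hr : 0 < r) :
    ∫ w in Metric.ball (0 : ℂ) r, (a + w)⁻¹ = (π * (min r ‖a‖) ^ 2 : ℝ) • a⁻¹ := by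
  have hint : IntegrableOn (fun w : ℂ => (a + w)⁻¹) (Metric.ball 0 r) := by
    refine (integrableOn_ball_norm_add_inv Complex.finrank_real_complex a r).mono'
      (by fun_prop) (by simp)
  have hmeas : StronglyMeasurable ((Metric.ball (0 : ℂ) r).indicator fun w => (a + w)⁻¹) :=
    (StronglyMeasurable.indicator (by fun_prop) measurableSet_ball)
  rw [← integral_indicator measurableSet_ball, integral_eq_integral_polar hmeas
    (hint.integrable_indicator measurableSet_ball)]
  have hae : ∀ᵐ ρ : ℝ ∂volume.restrict (Set.Ioi 0), ρ ≠ ‖a‖ := ae_restrict_of_ae (by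
    simp [ae_iff])
  calc
    _ = ∫ ρ in Set.Ioi (0 : ℝ), (Set.Ioc 0 (min r ‖a‖)).indicator
          (fun ρ : ℝ => ρ • ((2 * π : ℝ) • a⁻¹)) ρ := by
      refine integral_congr_ae ?_
      filter_upwards [hae, ae_restrict_mem measurableSet_Ioi, ae_restrict_of_ae (show ∀ᵐ ρ : ℝ, ρ ≠ r by simp [ae_iff])] with ρ hρa hρ hρr
      have hρ0 : (0 : ℝ) < ρ := hρ
      rcases lt_or_ge ρ r with hlt | hge
      · have h1 : ∀ θ ∈ Set.Ioo (-π) π,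
            ρ • (Metric.ball (0 : ℂ) r).indicator (fun w => (a + w)⁻¹)
              (ρ * (Real.cos θ + Real.sin θ * Complex.I)) =
            (ρ : ℂ) * a⁻¹ * (1 - (ρ * (Real.cos θ + Real.sin θ * Complex.I) : ℂ) /
              (ρ * (Real.cos θ + Real.sin θ * Complex.I) - (-a))) := by
          intro θ _
          have hn := norm_ofReal_mul_cos_add_sin ρ θ
          rw [abs_of_pos hρ0] at hn
          rw [Set.indicator_of_mem (by rwa [mem_ball_zero_iff, hn]), Complex.real_smul]
          set w : ℂ := ρ * (Real.cos θ + Real.sin θ * Complex.I)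
          have hw : a + w ≠ 0 := by
            intro h0
            apply hρa
            rw [← hn, ← norm_neg a, eq_neg_of_add_eq_zero_right h0]
          have hw' : w - -a ≠ 0 := by rwa [sub_neg_eq_add, add_comm]
          field_simp
          ring
        rw [setIntegral_congr_fun measurableSet_Ioo h1, integral_const_mul, integral_sub,
          setIntegral_Ioo_circle_div_sub hρ0 (by simpa using hρa.symm)]
        · simp only [norm_neg, integral_const, Set.indicator]
          rcases lt_or_ge ‖a‖ ρ with h | h
          · have : ¬ (ρ ∈ Set.Ioc 0 (min r ‖a‖)) := by simp; intros; linarith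
            rw [if_pos h, if_neg this]
            simp [Real.volume_real_Ioo_of_le (show -π ≤ π by linarith [pi_pos])]
            right; ring
          · have : ρ ∈ Set.Ioc 0 (min r ‖a‖) := by simp [hρ0, h, hlt.le]
            rw [if_neg h.not_gt, if_pos this]
            simp [Real.volume_real_Ioo_of_le (show -π ≤ π by linarith [pi_pos])]
            ring
        · exact integrable_const _
        · exact integrableOn_circle_div_sub hρ0 (by simpa using hρa.symm)
      · rw [Set.indicator_of_notMem]
        · refine (setIntegral_congr_fun measurableSet_Ioo (g := fun _ => 0) fun θ _ => ?_).trans (by simp)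
          have hn := norm_ofReal_mul_cos_add_sin ρ θ
          rw [abs_of_pos hρ0] at hn
          rw [Set.indicator_of_notMem (by rwa [mem_ball_zero_iff, hn, not_lt])]
          simp
        · simp
          intros
          exact absurd (lt_of_le_of_ne hge (Ne.symm hρr)) (by linarith)
    _ = _ := by
      rw [setIntegral_indicator measurableSet_Ioc, Set.inter_eq_right.2 (fun x hx => hx.1),
        ← intervalIntegral.integral_of_le (by positivity), intervalIntegral.integral_smul_const]
      simp
      ring

/-- The difference between the Biot-Savart kernel and its average over balls of radius `r`. -/
def localKernel (r : ℝ) (x : Plane) : Plane :=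
  max 0 (1 - ‖x‖ ^ 2 / r ^ 2) • biotSavartKernel x

@[fun_prop]
theorem measurable_localKernel (r : ℝ) : Measurable (localKernel r) := by
  have hc : Measurable fun x : Plane => max 0 (1 - ‖x‖ ^ 2 / r ^ 2) := by fun_prop
  exact hc.smul measurable_biotSavartKernel

theorem localKernel_eq_zero {r : ℝ} (hr : 0 < r) {x : Plane} (hx : r ≤ ‖x‖) :
    localKernel r x = 0 := by
  have : 1 - ‖x‖ ^ 2 / r ^ 2 ≤ 0 := by
    rw [sub_nonpos, one_le_div (by positivity)]
    gcongr
  rw [localKernel, max_eq_left this, zero_smul]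

theorem norm_localKernel_le (r : ℝ) (x : Plane) : ‖localKernel r x‖ ≤ ‖x‖⁻¹ := by
  rw [localKernel, norm_smul, Real.norm_of_nonneg (le_max_left _ _)]
  refine (mul_le_of_le_one_left (norm_nonneg _) ?_).trans (norm_biotSavartKernel_le x)
  exact max_le zero_le_one (sub_le_self _ (by positivity))

/-- Away from the origin this is `setIntegral_ball_inv` pushed through a real-linear map, with
`min(r, |x|)² = r² (1 - max(0, 1 - |x|²/r²))`. At the origin the kernel is odd. -/
theorem setIntegral_ball_biotSavartKernel {r : ℝ} (hr : 0 < r) (x : Plane) :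
    ∫ h in Metric.ball (0 : Plane) r, biotSavartKernel (x + h) =
      (Real.pi * r ^ 2) • (biotSavartKernel x - localKernel r x) := by
  rcases eq_or_ne x 0 with rfl | hx
  · have h0 : biotSavartKernel 0 = 0 := by simp [biotSavartKernel]
    have hodd : ∫ h in Metric.ball (0 : Plane) r, biotSavartKernel h = 0 := by
      have h1 := integral_neg_eq_self ((Metric.ball (0 : Plane) r).indicator biotSavartKernel)
        volume
      have h2 : ∀ h : Plane, (Metric.ball (0 : Plane) r).indicator biotSavartKernel (-h) =
          -(Metric.ball (0 : Plane) r).indicator biotSavartKernel h := by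
        intro h
        by_cases hh : h ∈ Metric.ball (0 : Plane) r
        · rw [Set.indicator_of_mem hh, Set.indicator_of_mem (by simpa using hh),
            biotSavartKernel_neg]
        · rw [Set.indicator_of_notMem hh, Set.indicator_of_notMem (by simpa using hh), neg_zero]
      simp only [h2, integral_neg] at h1
      rw [← integral_indicator measurableSet_ball]
      have h3 : (2 : ℝ) • ∫ h, (Metric.ball (0 : Plane) r).indicator biotSavartKernel h = 0 := by
        rw [two_smul]
        nth_rw 1 [← h1]
        exact neg_add_cancel _
      exact (smul_eq_zero.1 h3).resolve_left two_ne_zero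
    simp [localKernel, h0, hodd]
  obtain ⟨a, rfl⟩ := complexEquiv.surjective x
  have ha : a ≠ 0 := by rintro rfl; simp at hx
  let L : ℂ →L[ℝ] Plane := complexEquiv.toContinuousLinearEquiv.toContinuousLinearMap.comp
    ((ContinuousLinearMap.mul ℝ ℂ (1 / (2 * Real.pi) * Complex.I)).comp
      (Complex.conjCLE : ℂ →L[ℝ] ℂ))
  have hL : ∀ w : ℂ, biotSavartKernel (complexEquiv w) = L w⁻¹ := fun w =>
    biotSavartKernel_complexEquiv w
  have hint : IntegrableOn (fun w : ℂ => (a + w)⁻¹) (Metric.ball 0 r) :=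
    (integrableOn_ball_norm_add_inv Complex.finrank_real_complex a r).mono'
      (by fun_prop) (by simp)
  have hpre : complexEquiv ⁻¹' Metric.ball (0 : Plane) r = Metric.ball (0 : ℂ) r := by
    ext w
    simp
  rw [← measurePreserving_complexEquiv.setIntegral_preimage_emb measurableEmbedding_complexEquiv,
    hpre]
  simp only [← map_add, hL]
  rw [L.integral_comp_comm hint, setIntegral_ball_inv ha hr, map_smul, localKernel, hL,
    complexEquiv.norm_map]
  nth_rw 2 [← one_smul ℝ (L a⁻¹)]
  rw [← sub_smul, smul_smul]
  congr 1
  rw [mul_assoc]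
  congr 1
  rcases le_total ‖a‖ r with h | h
  · have : 0 ≤ 1 - ‖a‖ ^ 2 / r ^ 2 := by
      rw [sub_nonneg, div_le_one (by positivity)]
      gcongr
    rw [min_eq_right h, max_eq_right this]
    field_simp
    ring
  · have : 1 - ‖a‖ ^ 2 / r ^ 2 ≤ 0 := by
      rw [sub_nonpos, one_le_div (by positivity)]
      gcongr
    rw [min_eq_left h, max_eq_left this]
    ring

/-! ### Correlation of the kernel with the local kernel. -/

theorem inner_biotSavartKernel_complexEquiv (w z : ℂ) :
    inner ℝ (biotSavartKernel (complexEquiv w)) (biotSavartKernel (complexEquiv z)) =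
      (1 / (2 * Real.pi)) ^ 2 * (‖z‖ ^ 2)⁻¹ * (z / w).re := by
  have hz : (starRingEnd ℂ) z⁻¹ = ((‖z‖ ^ 2)⁻¹ : ℝ) * z := by
    rw [Complex.inv_def, map_mul, Complex.conj_conj, Complex.conj_ofReal,
      Complex.normSq_eq_norm_sq]
    push_cast
    ring
  rw [biotSavartKernel_complexEquiv, biotSavartKernel_complexEquiv, inner_complexEquiv, hz,
    ← Complex.re_ofReal_mul]
  congr 1
  simp only [map_mul, map_div₀, map_one, Complex.conj_I, Complex.conj_conj, Complex.conj_ofReal,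
    map_ofNat]
  push_cast
  linear_combination (-(1 / (2 * (Real.pi : ℂ))) ^ 2 * (‖z‖ ^ 2)⁻¹ * z / w) * Complex.I_sq

-- The local kernel is radial up to rotation, so in polar coordinates around its pole the only
-- angular dependence is that of `Re (w/(w - α))`. Its circle integral vanishes for radii below
-- `‖α‖`, and the cutoff kills radii above `r`.
open Real in
theorem enorm_integral_inner_localKernel_le {r : ℝ} (hr : 0 < r) (a : Plane) :
    ‖∫ x : Plane, inner ℝ (biotSavartKernel (x - a)) (localKernel r x)‖ₑ ≤
      ENNReal.ofReal (1 / (2 * π)) * ∫⁻ s in Set.Ioc ‖a‖ r, ENNReal.ofReal s⁻¹ := by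
  -- Integrability is not needed: otherwise the Bochner integral is zero by convention.
  by_cases hint : Integrable fun x : Plane =>
    inner ℝ (biotSavartKernel (x - a)) (localKernel r x)
  swap
  · simp [integral_undef hint]
  obtain ⟨α, rfl⟩ := complexEquiv.surjective a
  have hF : ∀ w : ℂ, inner ℝ (biotSavartKernel (complexEquiv w - complexEquiv α))
      (localKernel r (complexEquiv w)) =
      max 0 (1 - ‖w‖ ^ 2 / r ^ 2) * ((1 / (2 * π)) ^ 2 * (‖w‖ ^ 2)⁻¹ * (w / (w - α)).re) := by
    intro w
    rw [← map_sub, localKernel, inner_smul_right, inner_biotSavartKernel_complexEquiv,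
      complexEquiv.norm_map]
  rw [← measurePreserving_complexEquiv.integrable_comp_emb measurableEmbedding_complexEquiv] at hint
  rw [← measurePreserving_complexEquiv.integral_comp measurableEmbedding_complexEquiv,
    complexEquiv.norm_map]
  simp only [Function.comp_def, hF] at hint ⊢
  have hmeas : Measurable fun w : ℂ =>
      max 0 (1 - ‖w‖ ^ 2 / r ^ 2) * ((1 / (2 * π)) ^ 2 * (‖w‖ ^ 2)⁻¹ * (w / (w - α)).re) := by
    fun_prop
  rw [integral_eq_integral_polar hmeas.stronglyMeasurable hint, ← lintegral_const_mul _ (by fun_prop)]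
  refine (enorm_integral_le_lintegral_enorm _).trans ?_
  have hsub : Set.Ioc ‖α‖ r ⊆ Set.Ioi 0 := fun s hs => lt_of_le_of_lt (norm_nonneg _) hs.1
  rw [← Set.inter_eq_left.2 hsub, ← setLIntegral_indicator measurableSet_Ioc]
  have hae : ∀ᵐ ρ : ℝ ∂volume.restrict (Set.Ioi 0), ρ ≠ ‖α‖ := ae_restrict_of_ae (by
    simp [ae_iff])
  refine lintegral_mono_ae ?_
  filter_upwards [hae, ae_restrict_mem measurableSet_Ioi] with ρ hρα hρ
  have hρ0 : (0 : ℝ) < ρ := hρ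
  have hval : ∫ θ in Set.Ioo (-π) π, ((ρ * (Real.cos θ + Real.sin θ * Complex.I) : ℂ) /
        (ρ * (Real.cos θ + Real.sin θ * Complex.I) - α)).re =
        (if ‖α‖ < ρ then 2 * (π : ℂ) else 0).re := by
    rw [← setIntegral_Ioo_circle_div_sub hρ0 hρα.symm]
    exact (integral_re (integrableOn_circle_div_sub hρ0 hρα.symm))
  simp only [norm_ofReal_mul_cos_add_sin, abs_of_pos hρ0, smul_eq_mul, integral_const_mul, hval]
  rcases lt_or_ge ‖α‖ ρ with h | h
  · rcases le_or_gt ρ r with h' | h'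
    · rw [if_pos h, Set.indicator_of_mem (Set.mem_Ioc.2 ⟨h, h'⟩), ← ENNReal.ofReal_mul (by positivity),
        ← ofReal_norm]
      refine ENNReal.ofReal_le_ofReal ?_
      -- The cutoff is simply bounded by one; the rest is `ρ (2π)⁻² ρ⁻² 2π = (2πρ)⁻¹`.
      have h1 : |max 0 (1 - ρ ^ 2 / r ^ 2)| ≤ 1 := by
        rw [abs_of_nonneg (le_max_left _ _)]
        exact max_le zero_le_one (sub_le_self _ (by positivity))
      have h2 : (2 * (π : ℂ)).re = 2 * π := by simp
      rw [h2, Real.norm_eq_abs, mul_left_comm, abs_mul]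
      refine (mul_le_of_le_one_left (abs_nonneg _) h1).trans (le_of_eq ?_)
      rw [abs_of_pos (by positivity)]
      field_simp
    · have h1 : 1 - ρ ^ 2 / r ^ 2 ≤ 0 := by
        rw [sub_nonpos, one_le_div (by positivity)]
        gcongr
      rw [max_eq_left h1]
      simp
  · rw [if_neg h.not_gt]
    simp

/-! ### Layer-cake estimates under a power bound on the mass of balls. -/

/-- Tonelli: for fixed `s`, the points `y` with `‖x - y‖ < s` lie in the closed ball of radius `s`.
-/
theorem lintegral_lintegral_Ioc_norm_sub_le (μ : Measure Plane) [SFinite μ] {g : ℝ → ℝ≥0∞}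
    (hg : Measurable g) (x : Plane) (r : ℝ) :
    ∫⁻ y, (∫⁻ s in Set.Ioc ‖x - y‖ r, g s) ∂μ ≤
      ∫⁻ s in Set.Ioc 0 r, g s * μ (Metric.closedBall x s) := by
  have h1 : ∀ y : Plane, ∫⁻ s in Set.Ioc ‖x - y‖ r, g s =
      ∫⁻ s in Set.Ioc 0 r, (Set.Ioi ‖x - y‖).indicator g s := by
    intro y
    rw [setLIntegral_indicator measurableSet_Ioi]
    congr 2
    ext s
    simp only [Set.mem_Ioc, Set.mem_inter_iff, Set.mem_Ioi]
    exact ⟨fun h => ⟨h.1, (norm_nonneg _).trans_lt h.1, h.2⟩, fun h => ⟨h.1, h.2.2⟩⟩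
  simp only [h1]
  rw [lintegral_lintegral_swap]
  · refine lintegral_mono fun s => ?_
    have h2 : ∀ y : Plane, (Set.Ioi ‖x - y‖).indicator g s ≤
        (Metric.closedBall x s).indicator (fun _ => g s) y := by
      intro y
      by_cases h : ‖x - y‖ < s
      · rw [Set.indicator_of_mem (by exact h), Set.indicator_of_mem]
        rw [mem_closedBall_iff_norm']
        exact h.le
      · rw [Set.indicator_of_notMem (by exact h)]
        exact zero_le
    refine (lintegral_mono h2).trans (le_of_eq ?_)
    rw [lintegral_indicator measurableSet_closedBall]
    simp
  · have : (Function.uncurry fun (y : Plane) (s : ℝ) => (Set.Ioi ‖x - y‖).indicator g s) =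
        {p : Plane × ℝ | ‖x - p.1‖ < p.2}.indicator fun p => g p.2 := by
      ext ⟨y, s⟩
      simp [Set.indicator, Function.uncurry]
    rw [this]
    exact ((hg.comp measurable_snd).indicator
      (measurableSet_lt (by fun_prop) (by fun_prop))).aemeasurable

theorem lintegral_Ioc_ofReal_rpow {q r : ℝ} (hq : -1 < q) (hr : 0 ≤ r) :
    ∫⁻ s in Set.Ioc 0 r, ENNReal.ofReal (s ^ q) = ENNReal.ofReal (r ^ (q + 1) / (q + 1)) := by
  have hint : IntegrableOn (fun s : ℝ => s ^ q) (Set.Ioc 0 r) :=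
    (intervalIntegrable_iff_integrableOn_Ioc_of_le hr).1 (intervalIntegral.intervalIntegrable_rpow' hq)
  rw [← ofReal_integral_eq_lintegral_ofReal hint, ← intervalIntegral.integral_of_le hr,
    integral_rpow (Or.inl hq), Real.zero_rpow (by linarith), sub_zero]
  filter_upwards [ae_restrict_mem measurableSet_Ioc] with s hs
  exact Real.rpow_nonneg hs.1.le _

theorem lintegral_lintegral_Ioc_rpow_le {μ : Measure Plane} [SFinite μ] {C β r q : ℝ}
    (hr : 0 ≤ r) (hq : 0 < q + 1 + β)
    (hμ : ∀ x s, 0 < s → s ≤ r → μ (Metric.closedBall x s) ≤ ENNReal.ofReal (C * s ^ β))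
    (x : Plane) :
    ∫⁻ y, (∫⁻ s in Set.Ioc ‖x - y‖ r, ENNReal.ofReal (s ^ q)) ∂μ ≤
      ENNReal.ofReal C * ENNReal.ofReal (r ^ (q + 1 + β) / (q + 1 + β)) := by
  refine (lintegral_lintegral_Ioc_norm_sub_le μ (by fun_prop) x r).trans ?_
  calc
    _ ≤ ∫⁻ s in Set.Ioc 0 r, ENNReal.ofReal C * ENNReal.ofReal (s ^ (q + β)) := by
      refine setLIntegral_mono' measurableSet_Ioc fun s hs => ?_
      have hs0 : 0 < s := hs.1
      refine (mul_le_mul_right (hμ x s hs.1 hs.2) _).trans (le_of_eq ?_)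
      -- The primed lemma needs only `0 ≤ s ^ β`, so `C` may have any sign.
      rw [ENNReal.ofReal_mul' (by positivity), mul_left_comm,
        ← ENNReal.ofReal_mul (by positivity), Real.rpow_add hs0]
    _ = _ := by
      rw [lintegral_const_mul _ (by fun_prop), lintegral_Ioc_ofReal_rpow (by linarith) hr,
        add_right_comm]

/-- The fundamental theorem of calculus puts negative powers in layer-cake form. For `t = 0` the
left side is zero by the convention for `0 ^ (-γ)`. -/
theorem ofReal_rpow_neg_le {t r γ : ℝ} (ht : 0 ≤ t) (htr : t ≤ r) (hγ : 0 < γ) :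
    ENNReal.ofReal (t ^ (-γ)) ≤ ENNReal.ofReal (r ^ (-γ)) +
      ENNReal.ofReal γ * ∫⁻ s in Set.Ioc t r, ENNReal.ofReal (s ^ (-γ - 1)) := by
  rcases ht.eq_or_lt with rfl | ht
  · rw [Real.zero_rpow (by linarith)]
    simp
  have h0 : (0 : ℝ) ∉ Set.uIcc t r := by
    rw [Set.uIcc_of_le htr]
    exact fun h => absurd h.1 (not_le.2 ht)
  have hint : IntegrableOn (fun s : ℝ => s ^ (-γ - 1)) (Set.Ioc t r) :=
    (intervalIntegrable_iff_integrableOn_Ioc_of_le htr).1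
      (intervalIntegral.intervalIntegrable_rpow (Or.inr h0))
  have hr : 0 < r := ht.trans_le htr
  rw [← ofReal_integral_eq_lintegral_ofReal hint, ← intervalIntegral.integral_of_le htr,
    integral_rpow (Or.inr ⟨by linarith, h0⟩), ← ENNReal.ofReal_mul hγ.le,
    ← ENNReal.ofReal_add (by positivity)]
  · refine ENNReal.ofReal_le_ofReal (le_of_eq ?_)
    rw [show -γ - 1 + 1 = -γ by ring]
    field_simp
    ring
  · rw [show -γ - 1 + 1 = -γ by ring, div_neg, mul_neg, mul_div_cancel₀ _ hγ.ne', neg_sub, sub_nonneg]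
    exact Real.rpow_le_rpow_of_nonpos ht htr (by linarith)
  · filter_upwards [ae_restrict_mem measurableSet_Ioc] with s hs
    exact Real.rpow_nonneg (ht.trans hs.1).le _

theorem exists_lintegral_near_rpow_le {μ : Measure Plane} [IsFiniteMeasure μ] {C β r γ : ℝ}
    (hr : 0 < r) (hγ : 0 < γ) (hγβ : γ < β)
    (hμ : ∀ x s, 0 < s → s ≤ r → μ (Metric.closedBall x s) ≤ ENNReal.ofReal (C * s ^ β)) :
    ∃ A : ℝ≥0∞, A ≠ ⊤ ∧ ∀ x : Plane,
      ∫⁻ y in Metric.ball x r, ENNReal.ofReal (‖x - y‖ ^ (-γ)) ∂μ ≤ A := by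
  refine ⟨ENNReal.ofReal (r ^ (-γ)) * μ Set.univ + ENNReal.ofReal γ * (ENNReal.ofReal C *
    ENNReal.ofReal (r ^ (-γ - 1 + 1 + β) / (-γ - 1 + 1 + β))), by finiteness, fun x => ?_⟩
  calc
    _ ≤ ∫⁻ y in Metric.ball x r, (ENNReal.ofReal (r ^ (-γ)) + ENNReal.ofReal γ *
        (∫⁻ s in Set.Ioc ‖x - y‖ r, ENNReal.ofReal (s ^ (-γ - 1)))) ∂μ := by
      refine setLIntegral_mono' measurableSet_ball fun y hy => ?_
      refine ofReal_rpow_neg_le (norm_nonneg _) ?_ hγ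
      rw [mem_ball_iff_norm'] at hy
      exact hy.le
    _ ≤ ∫⁻ y, (ENNReal.ofReal (r ^ (-γ)) + ENNReal.ofReal γ *
        (∫⁻ s in Set.Ioc ‖x - y‖ r, ENNReal.ofReal (s ^ (-γ - 1)))) ∂μ := setLIntegral_le_lintegral _ _
    _ ≤ _ := by
      rw [lintegral_add_left (by fun_prop), lintegral_const, lintegral_const_mul' _ _ (by finiteness)]
      gcongr
      exact lintegral_lintegral_Ioc_rpow_le hr.le (by linarith) hμ x

/-! ### Integrability of the potentials that dominate the velocities. -/

section Potentials

theorem sq_lintegral_mul_le {α : Type*} [MeasurableSpace α] (μ : Measure α) {f g : α → ℝ≥0∞}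
    (hf : AEMeasurable f μ) (hg : AEMeasurable g μ) :
    (∫⁻ a, f a * g a ∂μ) ^ 2 ≤ (∫⁻ a, f a ^ 2 ∂μ) * ∫⁻ a, g a ^ 2 ∂μ := by
  have h := ENNReal.lintegral_mul_le_Lp_mul_Lq μ Real.HolderConjugate.two_two hf hg
  calc
    _ ≤ ((∫⁻ a, f a ^ (2 : ℝ) ∂μ) ^ (1 / (2 : ℝ)) * (∫⁻ a, g a ^ (2 : ℝ) ∂μ) ^ (1 / (2 : ℝ))) ^ 2 := by
      gcongr
      exact h
    _ = _ := by
      rw [mul_pow, ← ENNReal.rpow_natCast, ← ENNReal.rpow_natCast, ← ENNReal.rpow_mul,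
        ← ENNReal.rpow_mul]
      norm_num

theorem lintegral_lintegral_comp_sub (μ : Measure Plane) [SFinite μ] {f : Plane → ℝ≥0∞}
    (hf : Measurable f) :
    ∫⁻ x, (∫⁻ y, f (x - y) ∂μ) = μ Set.univ * ∫⁻ x, f x := by
  rw [lintegral_lintegral_swap (by fun_prop)]
  simp only [lintegral_sub_right_eq_self, lintegral_const]
  rw [mul_comm]

/-- The singular part of `x ↦ 1 / |x|`. -/
def nearKernel (r : ℝ) (x : Plane) : ℝ≥0∞ :=
  (Metric.ball (0 : Plane) r).indicator (fun x => ENNReal.ofReal ‖x‖⁻¹) x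

/-- A bounded substitute for `x ↦ 1 / |x|` at infinity. -/
def farKernel (x : Plane) : ℝ≥0∞ := ENNReal.ofReal (1 + ‖x‖)⁻¹

@[fun_prop]
theorem measurable_nearKernel (r : ℝ) : Measurable (nearKernel r) :=
  Measurable.indicator (by fun_prop) measurableSet_ball

@[fun_prop]
theorem measurable_farKernel : Measurable farKernel := by
  unfold farKernel
  fun_prop

theorem farKernel_le_one (x : Plane) : farKernel x ≤ 1 := by
  rw [farKernel, ENNReal.ofReal_le_one]
  exact inv_le_one_of_one_le₀ (by linarith [norm_nonneg x])

theorem ofReal_inv_norm_le {r : ℝ} (hr : 0 < r) (x : Plane) :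
    ENNReal.ofReal ‖x‖⁻¹ ≤ nearKernel r x + ENNReal.ofReal (1 + r⁻¹) * farKernel x := by
  by_cases hx : x ∈ Metric.ball (0 : Plane) r
  · rw [nearKernel, Set.indicator_of_mem hx]
    exact le_self_add
  · rw [nearKernel, Set.indicator_of_notMem hx, zero_add, farKernel,
      ← ENNReal.ofReal_mul (by positivity)]
    refine ENNReal.ofReal_le_ofReal ?_
    rw [mem_ball_zero_iff, not_lt] at hx
    have hx0 : 0 < ‖x‖ := hr.trans_le hx
    rw [inv_eq_one_div, ← div_eq_mul_inv, div_le_div_iff₀ hx0 (by positivity)]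
    have : 1 ≤ r⁻¹ * ‖x‖ := by
      rw [inv_mul_eq_div, one_le_div hr]
      exact hx
    linarith

theorem finrank_plane : Module.finrank ℝ Plane = 2 := by simp

theorem lintegral_ball_norm_rpow_ne_top {s : ℝ} (hs : -2 < s) (r : ℝ) :
    ∫⁻ x : Plane, (Metric.ball (0 : Plane) r).indicator (fun x => ENNReal.ofReal (‖x‖ ^ s)) x ≠ ⊤ := by
  rw [lintegral_indicator measurableSet_ball]
  have h := (integrableOn_ball_norm_rpow (E := Plane) finrank_plane hs r).lintegral_lt_top
  exact h.ne

theorem lintegral_nearKernel_ne_top (r : ℝ) : ∫⁻ x, nearKernel r x ≠ ⊤ := by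
  simpa [nearKernel, Real.rpow_neg_one] using!
    lintegral_ball_norm_rpow_ne_top (s := -1) (by norm_num) r

theorem lintegral_farKernel_pow_three_ne_top : ∫⁻ x, farKernel x ^ 3 ≠ ⊤ := by
  have h := (integrable_one_add_norm (E := Plane) (μ := volume) (r := 3)
    (by rw [finrank_plane]; norm_num)).lintegral_lt_top
  convert h.ne using 3 with x
  rw [farKernel, ← ENNReal.ofReal_pow (by positivity), Real.rpow_neg (by positivity)]
  norm_num

/-- The potential `∫ 1 / |x - y| dμ(y)`. -/
def inversePotential (μ : Measure Plane) (x : Plane) : ℝ≥0∞ :=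
  ∫⁻ y, ENNReal.ofReal ‖x - y‖⁻¹ ∂μ

/-- The part of the potential due to the mass at distance less than `r`. -/
def nearPotential (μ : Measure Plane) (r : ℝ) (x : Plane) : ℝ≥0∞ :=
  ∫⁻ y, nearKernel r (x - y) ∂μ

/-- The part of the potential due to the far mass. -/
def farPotential (μ : Measure Plane) (x : Plane) : ℝ≥0∞ :=
  ∫⁻ y, farKernel (x - y) ∂μ

variable {μ : Measure Plane}

@[fun_prop]
theorem measurable_nearPotential [SFinite μ] (r : ℝ) : Measurable (nearPotential μ r) :=
  Measurable.lintegral_prod_right (by fun_prop)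

@[fun_prop]
theorem measurable_farPotential [SFinite μ] : Measurable (farPotential μ) :=
  Measurable.lintegral_prod_right (by fun_prop)

theorem inversePotential_le {r : ℝ} (hr : 0 < r) (x : Plane) :
    inversePotential μ x ≤ nearPotential μ r x + ENNReal.ofReal (1 + r⁻¹) * farPotential μ x := by
  rw [nearPotential, farPotential, ← lintegral_const_mul _ (by fun_prop),
    ← lintegral_add_left (by fun_prop)]
  exact lintegral_mono fun y => ofReal_inv_norm_le hr _

theorem farPotential_le (x : Plane) : farPotential μ x ≤ μ Set.univ := by
  refine (lintegral_mono fun y => farKernel_le_one _).trans ?_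
  simp

theorem lintegral_nearPotential_ne_top [IsFiniteMeasure μ] (r : ℝ) :
    ∫⁻ x, nearPotential μ r x ≠ ⊤ := by
  simp only [nearPotential]
  rw [lintegral_lintegral_comp_sub μ (by fun_prop)]
  exact ENNReal.mul_ne_top (measure_ne_top _ _) (lintegral_nearKernel_ne_top r)

theorem ae_inversePotential_ne_top [IsFiniteMeasure μ] :
    ∀ᵐ x, inversePotential μ x ≠ ⊤ := by
  filter_upwards [ae_lt_top (measurable_nearPotential 1) (lintegral_nearPotential_ne_top (μ := μ) 1)]
    with x hx
  refine ne_top_of_le_ne_top ?_ (inversePotential_le one_pos x)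
  have := ne_top_of_le_ne_top (measure_ne_top μ _) (farPotential_le x)
  finiteness

/-- Cauchy–Schwarz against the finite measure moves the square onto the kernel, and `a² b ≤ a³ + b³`
separates the two factors. Cubes of `1/(1+|x|)` are integrable in the plane; squares are not, whence
the weight. -/
theorem lintegral_farPotential_sq_mul_ne_top [IsFiniteMeasure μ] :
    ∫⁻ x, farPotential μ x ^ 2 * farKernel x ≠ ⊤ := by
  have h1 : ∀ x, farPotential μ x ^ 2 * farKernel x ≤
      μ Set.univ * ((∫⁻ y, farKernel (x - y) ^ 3 ∂μ) + μ Set.univ * farKernel x ^ 3) := by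
    intro x
    have h2 := sq_lintegral_mul_le μ (f := fun _ => 1) (g := fun y => farKernel (x - y))
      (by fun_prop) (by fun_prop)
    simp only [one_mul, one_pow, lintegral_one] at h2
    calc
      _ ≤ (μ Set.univ * ∫⁻ y, farKernel (x - y) ^ 2 ∂μ) * farKernel x := by
        gcongr
        exact h2
      _ = μ Set.univ * ∫⁻ y, farKernel (x - y) ^ 2 * farKernel x ∂μ := by
        rw [lintegral_mul_const _ (by fun_prop), mul_assoc]
      _ ≤ μ Set.univ * ∫⁻ y, (farKernel (x - y) ^ 3 + farKernel x ^ 3) ∂μ := by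
        gcongr with y
        rcases le_total (farKernel (x - y)) (farKernel x) with h | h
        · calc
            _ ≤ farKernel x ^ 2 * farKernel x := by gcongr
            _ = farKernel x ^ 3 := by ring
            _ ≤ _ := le_add_self
        · calc
            _ ≤ farKernel (x - y) ^ 2 * farKernel (x - y) := by gcongr
            _ = farKernel (x - y) ^ 3 := by ring
            _ ≤ _ := le_self_add
      _ = _ := by
        rw [lintegral_add_left (by fun_prop), lintegral_const, mul_comm (farKernel x ^ 3)]
  refine ne_top_of_le_ne_top ?_ (lintegral_mono h1)
  have hm : Measurable fun x : Plane => ∫⁻ y, farKernel (x - y) ^ 3 ∂μ :=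
    Measurable.lintegral_prod_right  (by fun_prop)
  rw [lintegral_const_mul' _ _ (measure_ne_top _ _), lintegral_add_left hm,
    lintegral_const_mul' _ _ (measure_ne_top _ _),
    lintegral_lintegral_comp_sub μ (f := fun x => farKernel x ^ 3) (by fun_prop)]
  have := lintegral_farKernel_pow_three_ne_top
  finiteness

/-- With `γ = β/2`, split `|x-y|⁻¹ = |x-y|^(-γ/2) |x-y|^(γ/2-1)` and apply Cauchy–Schwarz. The first
square has a `μ`-integral bounded uniformly in `x`, because `γ < β`; the second, `|x|^(γ-2)`, is
locally integrable for Lebesgue measure, because `γ > 0`. -/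
theorem lintegral_nearPotential_sq_ne_top [IsFiniteMeasure μ] {C β r : ℝ} (hr : 0 < r)
    (hβ : 0 < β)
    (hμ : ∀ x s, 0 < s → s ≤ r → μ (Metric.closedBall x s) ≤ ENNReal.ofReal (C * s ^ β)) :
    ∫⁻ x, nearPotential μ r x ^ 2 ≠ ⊤ := by
  obtain ⟨A, hA, hAμ⟩ := exists_lintegral_near_rpow_le hr (half_pos hβ) (half_lt_self hβ) hμ
  set γ := β / 2 with hγ
  have hγ0 : 0 < γ := half_pos hβ
  set b : Plane → ℝ≥0∞ := fun x =>
    (Metric.ball (0 : Plane) r).indicator (fun x => ENNReal.ofReal (‖x‖ ^ (γ - 2))) x with hb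
  have hbm : Measurable b := Measurable.indicator (by fun_prop) measurableSet_ball
  have hmem : ∀ x y : Plane, x - y ∈ Metric.ball (0 : Plane) r ↔ y ∈ Metric.ball x r := by
    intro x y
    rw [mem_ball_zero_iff, mem_ball_iff_norm']
  have hind : ∀ (g : Plane → ℝ≥0∞) (x y : Plane), (Metric.ball (0 : Plane) r).indicator g (x - y) =
      (Metric.ball x r).indicator (fun y => g (x - y)) y := by
    intro g x y
    by_cases h : x - y ∈ Metric.ball (0 : Plane) r
    · rw [Set.indicator_of_mem h, Set.indicator_of_mem ((hmem x y).1 h)]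
    · rw [Set.indicator_of_notMem h, Set.indicator_of_notMem (mt (hmem x y).2 h)]
  have hsq : ∀ (x : Plane) (s : ℝ), ENNReal.ofReal (‖x‖ ^ s) ^ 2 = ENNReal.ofReal (‖x‖ ^ (s * 2)) := by
    intro x s
    rw [← ENNReal.ofReal_pow (by positivity), ← Real.rpow_mul_natCast (norm_nonneg _)]
    norm_num
  have h1 : ∀ x, nearPotential μ r x ^ 2 ≤ A * ∫⁻ y, b (x - y) ∂μ := by
    intro x
    calc
      _ = (∫⁻ y in Metric.ball x r, ENNReal.ofReal ‖x - y‖⁻¹ ∂μ) ^ 2 := by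
        rw [nearPotential, ← lintegral_indicator measurableSet_ball]
        congr 2 with y
        exact hind _ x y
      _ ≤ (∫⁻ y in Metric.ball x r, ENNReal.ofReal (‖x - y‖ ^ (-γ / 2)) *
            ENNReal.ofReal (‖x - y‖ ^ (γ / 2 - 1)) ∂μ) ^ 2 := by
        gcongr with y
        rw [← ENNReal.ofReal_mul (by positivity)]
        refine ENNReal.ofReal_le_ofReal ?_
        -- On the diagonal `0⁻¹ = 0`, so only an inequality is claimed.
        rcases (norm_nonneg (x - y)).eq_or_lt with h0 | h0
        · rw [← h0, inv_zero]
          positivity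
        · rw [← Real.rpow_add h0, ← Real.rpow_neg_one]
          refine le_of_eq ?_
          congr 1
          ring
      _ ≤ (∫⁻ y in Metric.ball x r, ENNReal.ofReal (‖x - y‖ ^ (-γ / 2)) ^ 2 ∂μ) *
            ∫⁻ y in Metric.ball x r, ENNReal.ofReal (‖x - y‖ ^ (γ / 2 - 1)) ^ 2 ∂μ :=
        sq_lintegral_mul_le _ (by fun_prop) (by fun_prop)
      _ = (∫⁻ y in Metric.ball x r, ENNReal.ofReal (‖x - y‖ ^ (-γ)) ∂μ) *
            ∫⁻ y, b (x - y) ∂μ := by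
        simp only [hsq]
        rw [show -γ / 2 * 2 = -γ by ring, show (γ / 2 - 1) * 2 = γ - 2 by ring,
          ← lintegral_indicator (f := fun y => ENNReal.ofReal (‖x - y‖ ^ (γ - 2)))
            measurableSet_ball]
        congr 2 with y
        exact (hind (fun x => ENNReal.ofReal (‖x‖ ^ (γ - 2))) x y).symm
      _ ≤ _ := by
        gcongr
        exact hAμ x
  refine ne_top_of_le_ne_top ?_ (lintegral_mono h1)
  rw [lintegral_const_mul' _ _ hA, lintegral_lintegral_comp_sub μ hbm]
  have := lintegral_ball_norm_rpow_ne_top (s := γ - 2) (by linarith) r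
  finiteness

theorem lintegral_inversePotential_sq_mul_ne_top [IsFiniteMeasure μ] {C β r : ℝ} (hr : 0 < r)
    (hβ : 0 < β)
    (hμ : ∀ x s, 0 < s → s ≤ r → μ (Metric.closedBall x s) ≤ ENNReal.ofReal (C * s ^ β)) :
    ∫⁻ x, inversePotential μ x ^ 2 * farKernel x ≠ ⊤ := by
  set c : ℝ≥0∞ := ENNReal.ofReal (1 + r⁻¹)
  have h1 : ∀ x, inversePotential μ x ^ 2 * farKernel x ≤
      4 * (nearPotential μ r x ^ 2 + c ^ 2 * (farPotential μ x ^ 2 * farKernel x)) := by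
    intro x
    have h2 : inversePotential μ x ^ 2 ≤
        4 * (nearPotential μ r x ^ 2 + (c * farPotential μ x) ^ 2) := by
      have h3 := inversePotential_le (μ := μ) hr x
      rcases le_total (nearPotential μ r x) (c * farPotential μ x) with h | h
      · calc
          _ ≤ (c * farPotential μ x + c * farPotential μ x) ^ 2 := by
            gcongr
            exact h3.trans (by gcongr)
          _ = 4 * (c * farPotential μ x) ^ 2 := by ring
          _ ≤ _ := by gcongr; exact le_add_self
      · calc
          _ ≤ (nearPotential μ r x + nearPotential μ r x) ^ 2 := by
            gcongr
            exact h3.trans (by gcongr)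
          _ = 4 * nearPotential μ r x ^ 2 := by ring
          _ ≤ _ := by gcongr; exact le_self_add
    calc
      _ ≤ 4 * (nearPotential μ r x ^ 2 + (c * farPotential μ x) ^ 2) * farKernel x := by gcongr
      _ = 4 * (nearPotential μ r x ^ 2 * farKernel x +
            c ^ 2 * (farPotential μ x ^ 2 * farKernel x)) := by ring
      _ ≤ _ := by
        gcongr
        exact mul_le_of_le_one_right' (farKernel_le_one x)
  refine ne_top_of_le_ne_top ?_ (lintegral_mono h1)
  rw [lintegral_const_mul' _ _ (by finiteness), lintegral_add_left (by fun_prop),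
    lintegral_const_mul' _ _ (by finiteness)]
  have := lintegral_nearPotential_sq_ne_top hr hβ hμ
  have := lintegral_farPotential_sq_mul_ne_top (μ := μ)
  finiteness

/-- The far potential is bounded and the near one lies in `L¹ ∩ L²`. This justifies every use of
Fubini in `∫ u·v`. -/
theorem lintegral_inversePotential_mul_nearPotential_ne_top [IsFiniteMeasure μ] {C β r : ℝ}
    (hr : 0 < r) (hβ : 0 < β)
    (hμ : ∀ x s, 0 < s → s ≤ r → μ (Metric.closedBall x s) ≤ ENNReal.ofReal (C * s ^ β)) :
    ∫⁻ x, inversePotential μ x * nearPotential μ r x ≠ ⊤ := by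
  set c : ℝ≥0∞ := ENNReal.ofReal (1 + r⁻¹)
  have h1 : ∀ x, inversePotential μ x * nearPotential μ r x ≤
      nearPotential μ r x ^ 2 + c * μ Set.univ * nearPotential μ r x := by
    intro x
    calc
      _ ≤ (nearPotential μ r x + c * μ Set.univ) * nearPotential μ r x := by
        gcongr
        refine (inversePotential_le hr x).trans ?_
        gcongr
        exact farPotential_le x
      _ = _ := by ring
  refine ne_top_of_le_ne_top ?_ (lintegral_mono h1)
  rw [lintegral_add_left (by fun_prop), lintegral_const_mul' _ _ (by finiteness)]
  have := lintegral_nearPotential_sq_ne_top hr hβ hμ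
  have := lintegral_nearPotential_ne_top (μ := μ) r
  finiteness

/-! ### The velocity, its local part, and their pairing. -/

/-- The velocity induced by the vorticity `σ μ`. -/
def velocity (μ : Measure Plane) (σ : Plane → ℝ) (x : Plane) : Plane :=
  ∫ y, σ y • biotSavartKernel (x - y) ∂μ

/-- The difference between the velocity and its average over balls of radius `r`. -/
def localVelocity (μ : Measure Plane) (σ : Plane → ℝ) (r : ℝ) (x : Plane) : Plane :=
  ∫ y, σ y • localKernel r (x - y) ∂μ

variable {σ : Plane → ℝ}

theorem enorm_smul_biotSavartKernel_le (hσ : ∀ y, |σ y| ≤ 1) (x y : Plane) :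
    ‖σ y • biotSavartKernel x‖ₑ ≤ ENNReal.ofReal ‖x‖⁻¹ := by
  rw [← ofReal_norm]
  refine ENNReal.ofReal_le_ofReal ?_
  rw [norm_smul]
  exact (mul_le_of_le_one_left (norm_nonneg _) (hσ y)).trans (norm_biotSavartKernel_le _)

theorem enorm_smul_localKernel_le {r : ℝ} (hr : 0 < r) (hσ : ∀ y, |σ y| ≤ 1) (x y : Plane) :
    ‖σ y • localKernel r x‖ₑ ≤ nearKernel r x := by
  by_cases hx : x ∈ Metric.ball (0 : Plane) r
  · rw [nearKernel, Set.indicator_of_mem hx, ← ofReal_norm]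
    refine ENNReal.ofReal_le_ofReal ?_
    rw [norm_smul]
    exact (mul_le_of_le_one_left (norm_nonneg _) (hσ y)).trans (norm_localKernel_le r _)
  · rw [localKernel_eq_zero hr (by simpa using hx)]
    simp

theorem enorm_inner_le (a b : Plane) : ‖inner ℝ a b‖ₑ ≤ ‖a‖ₑ * ‖b‖ₑ := by
  rw [← ofReal_norm, ← ofReal_norm, ← ofReal_norm, ← ENNReal.ofReal_mul (norm_nonneg _)]
  exact ENNReal.ofReal_le_ofReal (norm_inner_le_norm a b)

theorem stronglyMeasurable_velocity [SFinite μ] (hσm : Measurable σ) :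
    StronglyMeasurable (velocity μ σ) := by
  refine StronglyMeasurable.integral_prod_right (f := fun x y => σ y • biotSavartKernel (x - y)) ?_
  refine Measurable.stronglyMeasurable ?_
  simp only [Function.uncurry_def]
  fun_prop

theorem stronglyMeasurable_localVelocity [SFinite μ] (hσm : Measurable σ) (r : ℝ) :
    StronglyMeasurable (localVelocity μ σ r) := by
  refine StronglyMeasurable.integral_prod_right (f := fun x y => σ y • localKernel r (x - y)) ?_
  refine Measurable.stronglyMeasurable ?_
  simp only [Function.uncurry_def]
  fun_prop

theorem enorm_velocity_le (hσ : ∀ y, |σ y| ≤ 1) (x : Plane) :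
    ‖velocity μ σ x‖ₑ ≤ inversePotential μ x :=
  (enorm_integral_le_lintegral_enorm _).trans
    (lintegral_mono fun y => enorm_smul_biotSavartKernel_le hσ _ y)

theorem enorm_localVelocity_le {r : ℝ} (hr : 0 < r) (hσ : ∀ y, |σ y| ≤ 1) (x : Plane) :
    ‖localVelocity μ σ r x‖ₑ ≤ nearPotential μ r x :=
  (enorm_integral_le_lintegral_enorm _).trans
    (lintegral_mono fun y => enorm_smul_localKernel_le hr hσ _ y)

theorem nearPotential_le_inversePotential (r : ℝ) (x : Plane) :
    nearPotential μ r x ≤ inversePotential μ x :=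
  lintegral_mono fun _ => Set.indicator_le_self _ _ _

theorem integrable_smul_biotSavartKernel (hσm : Measurable σ) (hσ : ∀ y, |σ y| ≤ 1) {x : Plane}
    (hx : inversePotential μ x ≠ ⊤) : Integrable (fun y => σ y • biotSavartKernel (x - y)) μ :=
  ⟨Measurable.aestronglyMeasurable (by fun_prop),
    (lintegral_mono fun y => enorm_smul_biotSavartKernel_le hσ _ y).trans_lt hx.lt_top⟩

theorem integrable_smul_localKernel (hσm : Measurable σ) (hσ : ∀ y, |σ y| ≤ 1) {r : ℝ} (hr : 0 < r)
    {x : Plane} (hx : inversePotential μ x ≠ ⊤) :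
    Integrable (fun y => σ y • localKernel r (x - y)) μ :=
  ⟨Measurable.aestronglyMeasurable (by fun_prop),
    ((lintegral_mono fun y => enorm_smul_localKernel_le hr hσ _ y).trans
      (nearPotential_le_inversePotential r x)).trans_lt hx.lt_top⟩

theorem lintegral_ball_ofReal_inv_norm_add_le (a : Plane) (r : ℝ) :
    ∫⁻ h in Metric.ball (0 : Plane) r, ENNReal.ofReal ‖a + h‖⁻¹ ≤
      (∫⁻ x, nearKernel 1 x) + 2 * volume (Metric.ball (0 : Plane) r) := by
  calc
    _ ≤ ∫⁻ h in Metric.ball (0 : Plane) r, (nearKernel 1 (a + h) + 2) := by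
      gcongr with h
      refine (ofReal_inv_norm_le one_pos (a + h)).trans ?_
      gcongr
      refine (mul_le_mul_right (farKernel_le_one _) _).trans (le_of_eq ?_)
      norm_num
    _ = (∫⁻ h in Metric.ball (0 : Plane) r, nearKernel 1 (a + h)) +
        2 * volume (Metric.ball (0 : Plane) r) := by
      rw [lintegral_add_left (by fun_prop)]
      simp
    _ ≤ (∫⁻ h, nearKernel 1 (a + h)) + 2 * volume (Metric.ball (0 : Plane) r) := by
      gcongr
      exact Measure.restrict_le_self
    _ = _ := by rw [lintegral_add_left_eq_self]

/-- The integral of `1/|a + h|` over the ball in `h` is bounded uniformly in `a`, and `μ` is finite.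
This holds at every `x`, even where the potential is infinite. -/
theorem integrable_biotSavartKernel_ball_prod [IsFiniteMeasure μ] (hσm : Measurable σ)
    (hσ : ∀ y, |σ y| ≤ 1) (r : ℝ) (x : Plane) :
    Integrable (Function.uncurry fun (h y : Plane) => σ y • biotSavartKernel (x + h - y))
      ((volume.restrict (Metric.ball (0 : Plane) r)).prod μ) := by
  refine ⟨Measurable.aestronglyMeasurable (by simp only [Function.uncurry_def]; fun_prop), ?_⟩
  rw [HasFiniteIntegral, lintegral_prod_symm' _ (by simp only [Function.uncurry_def]; fun_prop)]
  refine (lintegral_mono (g := fun _ => (∫⁻ x, nearKernel 1 x) +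
    2 * volume (Metric.ball (0 : Plane) r)) fun y => ?_).trans_lt ?_
  · refine le_trans (lintegral_mono fun h => ?_) (lintegral_ball_ofReal_inv_norm_add_le (x - y) r)
    simp only [Function.uncurry]
    refine (enorm_smul_biotSavartKernel_le hσ _ y).trans (le_of_eq ?_)
    rw [add_sub_right_comm]
  · rw [lintegral_const]
    have := lintegral_nearKernel_ne_top 1
    have : volume (Metric.ball (0 : Plane) r) ≠ ⊤ := measure_ball_lt_top.ne
    finiteness

theorem integrableOn_ball_velocity [IsFiniteMeasure μ] (hσm : Measurable σ)
    (hσ : ∀ y, |σ y| ≤ 1) (r : ℝ) (x : Plane) :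
    IntegrableOn (fun h => velocity μ σ (x + h)) (Metric.ball 0 r) :=
  (integrable_biotSavartKernel_ball_prod hσm hσ r x).integral_prod_left

theorem setIntegral_ball_velocity [IsFiniteMeasure μ] (hσm : Measurable σ) (hσ : ∀ y, |σ y| ≤ 1)
    {r : ℝ} (hr : 0 < r) {x : Plane} (hx : inversePotential μ x ≠ ⊤) :
    ∫ h in Metric.ball (0 : Plane) r, velocity μ σ (x + h) =
      volume.real (Metric.ball (0 : Plane) r) • (velocity μ σ x - localVelocity μ σ r x) := by
  have hvol : volume.real (Metric.ball (0 : Plane) r) = Real.pi * r ^ 2 := by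
    rw [Measure.real, EuclideanSpace.volume_ball_fin_two]
    simp [hr.le, Real.pi_nonneg, mul_comm]
  simp only [velocity]
  rw [integral_integral_swap (integrable_biotSavartKernel_ball_prod hσm hσ r x), localVelocity,
    ← integral_sub (integrable_smul_biotSavartKernel hσm hσ hx)
      (integrable_smul_localKernel hσm hσ hr hx), ← integral_smul, hvol]
  refine integral_congr_ae (Filter.Eventually.of_forall fun y => ?_)
  simp only [integral_smul, add_sub_right_comm x _ y, setIntegral_ball_biotSavartKernel hr]
  rw [← smul_sub, smul_comm]

theorem inner_velocity_localVelocity [SFinite μ] (hσm : Measurable σ) (hσ : ∀ y, |σ y| ≤ 1)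
    {r : ℝ} (hr : 0 < r) {x : Plane} (hx : inversePotential μ x ≠ ⊤) :
    inner ℝ (velocity μ σ x) (localVelocity μ σ r x) =
      ∫ p : Plane × Plane, inner ℝ (σ p.1 • biotSavartKernel (x - p.1))
        (σ p.2 • localKernel r (x - p.2)) ∂(μ.prod μ) := by
  have h1 := integrable_smul_biotSavartKernel hσm hσ hx
  have h2 := integrable_smul_localKernel hσm hσ hr hx
  have h3 : Integrable (fun p : Plane × Plane => inner ℝ (σ p.1 • biotSavartKernel (x - p.1))
        (σ p.2 • localKernel r (x - p.2))) (μ.prod μ) := by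
    refine (h1.norm.mul_prod h2.norm).mono' (Measurable.aestronglyMeasurable (by fun_prop)) ?_
    exact Filter.Eventually.of_forall fun p => norm_inner_le_norm _ _
  rw [integral_prod _ h3]
  simp only [integral_inner h2]
  rw [← localVelocity, velocity, real_inner_comm, ← integral_inner h1]
  simp only [real_inner_comm]

theorem integrable_inner_velocity_localVelocity [IsFiniteMeasure μ] (hσm : Measurable σ)
    (hσ : ∀ y, |σ y| ≤ 1) {C β r : ℝ} (hr : 0 < r) (hβ : 0 < β)
    (hμ : ∀ x s, 0 < s → s ≤ r → μ (Metric.closedBall x s) ≤ ENNReal.ofReal (C * s ^ β)) :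
    Integrable fun x => inner ℝ (velocity μ σ x) (localVelocity μ σ r x) := by
  refine ⟨((stronglyMeasurable_velocity hσm).inner
    (stronglyMeasurable_localVelocity hσm r)).aestronglyMeasurable, ?_⟩
  refine (lintegral_mono fun x => ?_).trans_lt
    (lintegral_inversePotential_mul_nearPotential_ne_top hr hβ hμ).lt_top
  refine (enorm_inner_le _ _).trans ?_
  gcongr
  · exact enorm_velocity_le hσ x
  · exact enorm_localVelocity_le hr hσ x

theorem enorm_integral_inner_velocity_localVelocity_le [IsFiniteMeasure μ] (hσm : Measurable σ)
    (hσ : ∀ y, |σ y| ≤ 1) {C β r : ℝ} (hr : 0 < r) (hβ : 0 < β)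
    (hμ : ∀ x s, 0 < s → s ≤ r → μ (Metric.closedBall x s) ≤ ENNReal.ofReal (C * s ^ β)) :
    ‖∫ x, inner ℝ (velocity μ σ x) (localVelocity μ σ r x)‖ₑ ≤
      ENNReal.ofReal (1 / (2 * Real.pi)) * (ENNReal.ofReal C * ENNReal.ofReal (r ^ β / β)) *
        μ Set.univ := by
  set H : Plane → Plane × Plane → ℝ := fun x p =>
    inner ℝ (σ p.1 • biotSavartKernel (x - p.1)) (σ p.2 • localKernel r (x - p.2)) with hH
  have hHm : Measurable (Function.uncurry H) := by
    simp only [hH, Function.uncurry_def]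
    fun_prop
  have hHi : Integrable (Function.uncurry H) (volume.prod (μ.prod μ)) := by
    refine ⟨hHm.aestronglyMeasurable, ?_⟩
    rw [HasFiniteIntegral, lintegral_prod _ (by fun_prop)]
    refine (lintegral_mono fun x => ?_).trans_lt
      (lintegral_inversePotential_mul_nearPotential_ne_top hr hβ hμ).lt_top
    rw [inversePotential, nearPotential, ← lintegral_prod_mul (by fun_prop) (by fun_prop)]
    refine lintegral_mono fun p => ?_
    refine (enorm_inner_le _ _).trans ?_
    gcongr
    · exact enorm_smul_biotSavartKernel_le hσ _ _
    · exact enorm_smul_localKernel_le hr hσ _ _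
  have h1 : ∫ x, inner ℝ (velocity μ σ x) (localVelocity μ σ r x) =
      ∫ x, ∫ p, H x p ∂(μ.prod μ) := by
    refine integral_congr_ae ?_
    filter_upwards [ae_inversePotential_ne_top (μ := μ)] with x hx
    exact inner_velocity_localVelocity hσm hσ hr hx
  rw [h1, integral_integral_swap hHi]
  refine (enorm_integral_le_lintegral_enorm _).trans ((lintegral_prod_le _).trans ?_)
  have h2 : ∀ y z : Plane, ‖∫ x, H x (y, z)‖ₑ ≤ ENNReal.ofReal (1 / (2 * Real.pi)) *
      ∫⁻ s in Set.Ioc ‖y - z‖ r, ENNReal.ofReal (s ^ (-1 : ℝ)) := by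
    intro y z
    simp only [hH, real_inner_smul_left, real_inner_smul_right, integral_const_mul]
    rw [enorm_mul, enorm_mul]
    have h3 : ∀ y, ‖σ y‖ₑ ≤ 1 := fun y => by
      rw [← ofReal_norm, ENNReal.ofReal_le_one]
      exact hσ y
    refine (mul_le_of_le_one_left' (h3 z)).trans ((mul_le_of_le_one_left' (h3 y)).trans ?_)
    -- Translating by `z` moves the pole of the local kernel to the origin.
    rw [← integral_add_right_eq_self _ z]
    simp only [add_sub_cancel_right, Real.rpow_neg_one]
    refine le_trans (le_of_eq ?_) (enorm_integral_inner_localKernel_le hr (y - z))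
    congr 2 with x
    congr 2
    abel
  calc
    _ ≤ ∫⁻ y, ENNReal.ofReal (1 / (2 * Real.pi)) *
          (ENNReal.ofReal C * ENNReal.ofReal (r ^ β / β)) ∂μ := by
      refine lintegral_mono fun y => (lintegral_mono fun z => h2 y z).trans ?_
      rw [lintegral_const_mul' _ _ ENNReal.ofReal_ne_top]
      gcongr
      have := lintegral_lintegral_Ioc_rpow_le (q := -1) hr.le (by simpa) hμ y
      simpa using this
    _ = _ := by rw [lintegral_const]

theorem integrable_norm_velocity_sq_div [IsFiniteMeasure μ] (hσm : Measurable σ)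
    (hσ : ∀ y, |σ y| ≤ 1) {C β r : ℝ} (hr : 0 < r) (hβ : 0 < β)
    (hμ : ∀ x s, 0 < s → s ≤ r → μ (Metric.closedBall x s) ≤ ENNReal.ofReal (C * s ^ β)) :
    Integrable fun x => ‖velocity μ σ x‖ ^ 2 / (1 + ‖x‖) := by
  have hm := (stronglyMeasurable_velocity (μ := μ) hσm).measurable
  refine ⟨Measurable.aestronglyMeasurable (by fun_prop), ?_⟩
  refine (lintegral_mono fun x => ?_).trans_lt
    (lintegral_inversePotential_sq_mul_ne_top hr hβ hμ).lt_top
  rw [Real.enorm_of_nonneg (by positivity)]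
  beta_reduce
  rw [div_eq_mul_inv, ENNReal.ofReal_mul (by positivity),
    ENNReal.ofReal_pow (norm_nonneg _), ofReal_norm]
  gcongr
  · exact enorm_velocity_le hσ x
  · rfl

end Potentials

/-! ### Square increments with a weight, and removal of the weight. -/

/-- The cost of translating the weight is additive with leading constant one, so the main terms
still cancel. -/
theorem weight_le_add {N : ℝ} (hN : 0 < N) {x y : Plane} {r : ℝ} (hxy : ‖x‖ ≤ ‖y‖ + r) (hr : 0 ≤ r) :
    N / (N + ‖y‖) ≤ N / (N + ‖x‖) + r * (1 / (N + ‖x‖)) := by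
  have hx := norm_nonneg x
  have hy := norm_nonneg y
  rw [mul_one_div, ← add_div, div_le_div_iff₀ (by positivity) (by positivity)]
  nlinarith [mul_nonneg hr hy, mul_nonneg hN.le (sub_nonneg.2 hxy)]

/-- A cruder comparison, sufficient for integrability of the translated term. -/
theorem weight_le_mul {N : ℝ} (hN : 1 ≤ N) {x y : Plane} {r : ℝ} (hxy : ‖y‖ ≤ ‖x‖ + r) (hr : 0 ≤ r) :
    N / (N + ‖x‖) ≤ (1 + r) * (N / (N + ‖y‖)) := by
  have hx := norm_nonneg x
  have hy := norm_nonneg y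
  rw [← mul_div_assoc, div_le_div_iff₀ (by positivity) (by positivity)]
  have h1 : N + ‖y‖ ≤ (1 + r) * (N + ‖x‖) := by
    nlinarith [mul_nonneg hr hx, mul_nonneg hr (sub_nonneg.2 hN)]
  have := mul_le_mul_of_nonneg_left h1 (by linarith : (0 : ℝ) ≤ N)
  linarith

theorem integrable_comp_add_prod {E : Type*} [NormedAddCommGroup E] {g : Plane → E}
    (hm : StronglyMeasurable g) (hg : Integrable g) (ν : Measure Plane) [IsFiniteMeasure ν] :
    Integrable (fun p : Plane × Plane => g (p.2 + p.1)) (ν.prod volume) := by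
  refine ⟨(hm.comp_measurable (by fun_prop)).aestronglyMeasurable, ?_⟩
  have hme : Measurable fun p : Plane × Plane => ‖g (p.2 + p.1)‖ₑ :=
    hm.enorm.comp (by fun_prop)
  rw [HasFiniteIntegral, lintegral_prod _ hme.aemeasurable]
  simp only [lintegral_add_right_eq_self (fun x => ‖g x‖ₑ), lintegral_const]
  have := hg.2
  rw [HasFiniteIntegral] at this
  finiteness

/-- The square increments of `u`, localized by the weight `N / (N + |x|)`. -/
theorem integral_weight_increment_le {u v : Plane → Plane} {r N : ℝ} (hr : 0 < r) (hN : 1 ≤ N)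
    (hum : StronglyMeasurable u)
    (hu : Integrable fun x => ‖u x‖ ^ 2 / (1 + ‖x‖))
    (huB : ∀ᵐ x, IntegrableOn (fun h => u (x + h)) (Metric.ball 0 r))
    (havg : ∀ᵐ x, ∫ h in Metric.ball (0 : Plane) r, u (x + h) =
      volume.real (Metric.ball (0 : Plane) r) • (u x - v x)) :
    Integrable (fun p : Plane × Plane => N / (N + ‖p.2‖) * ‖u (p.2 + p.1) - u p.2‖ ^ 2)
      ((volume.restrict (Metric.ball (0 : Plane) r)).prod volume) ∧
    ∫ p : Plane × Plane, N / (N + ‖p.2‖) * ‖u (p.2 + p.1) - u p.2‖ ^ 2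
        ∂((volume.restrict (Metric.ball (0 : Plane) r)).prod volume) ≤
      volume.real (Metric.ball (0 : Plane) r) * (r * ∫ x, ‖u x‖ ^ 2 / (N + ‖x‖)) +
        2 * (volume.real (Metric.ball (0 : Plane) r) * ∫ x, N / (N + ‖x‖) * inner ℝ (u x) (v x)) := by
  have humm : Measurable u := hum.measurable
  have hN0 : 0 < N := by linarith
  set V := volume.real (Metric.ball (0 : Plane) r) with hV
  set ν := volume.restrict (Metric.ball (0 : Plane) r) with hν
  have hνV : ν.real Set.univ = V := by simp [hν, hV, Measure.real]
  have : IsFiniteMeasure ν := ⟨by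
    rw [hν, Measure.restrict_apply_univ]
    exact measure_ball_lt_top⟩
  have hmemB : ∀ᵐ p : Plane × Plane ∂(ν.prod volume), ‖p.1‖ < r := by
    have h := ae_restrict_mem (μ := volume) (measurableSet_ball (x := (0 : Plane)) (ε := r))
    filter_upwards [Measure.quasiMeasurePreserving_fst.ae h] with p hp
    exact mem_ball_zero_iff.1 hp
  have hE : Integrable fun x => ‖u x‖ ^ 2 / (N + ‖x‖) := by
    refine hu.mono' (Measurable.aestronglyMeasurable (by fun_prop))
      (Filter.Eventually.of_forall fun x => ?_)
    rw [Real.norm_of_nonneg (by positivity)]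
    gcongr
  have hg : Integrable fun x => N / (N + ‖x‖) * ‖u x‖ ^ 2 :=
    (hE.const_mul N).congr (Filter.Eventually.of_forall fun x => by ring)
  have hgm : Measurable fun x => N / (N + ‖x‖) * ‖u x‖ ^ 2 := by fun_prop
  have hb : Integrable (fun p : Plane × Plane => N / (N + ‖p.2‖) * ‖u p.2‖ ^ 2)
      (ν.prod volume) := hg.comp_snd ν
  have ha : Integrable (fun p : Plane × Plane => N / (N + ‖p.2‖) * ‖u (p.2 + p.1)‖ ^ 2)
      (ν.prod volume) := by
    refine ((integrable_comp_add_prod hgm.stronglyMeasurable hg ν).const_mul (1 + r)).mono'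
      (Measurable.aestronglyMeasurable (by fun_prop)) ?_
    filter_upwards [hmemB] with p hp
    rw [Real.norm_of_nonneg (by positivity), ← mul_assoc]
    gcongr
    exact weight_le_mul hN ((norm_add_le _ _).trans (by linarith)) hr.le
  have hc : Integrable (fun p : Plane × Plane => N / (N + ‖p.2‖) * inner ℝ (u p.2) (u (p.2 + p.1)))
      (ν.prod volume) := by
    refine (ha.add hb).mono' (Measurable.aestronglyMeasurable (by fun_prop))
      (Filter.Eventually.of_forall fun p => ?_)
    rw [Pi.add_apply, ← mul_add, norm_mul, Real.norm_of_nonneg (by positivity)]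
    gcongr
    refine (norm_inner_le_norm _ _).trans ?_
    nlinarith [sq_nonneg (‖u p.2‖ - ‖u (p.2 + p.1)‖), sq_nonneg ‖u p.2‖,
      sq_nonneg ‖u (p.2 + p.1)‖]
  -- The first difference cancels up to the translation error; the second becomes the pairing of `u`
  -- with `v`.
  have hexp : (fun p : Plane × Plane => N / (N + ‖p.2‖) * ‖u (p.2 + p.1) - u p.2‖ ^ 2) =
      fun p : Plane × Plane => (N / (N + ‖p.2‖) * ‖u (p.2 + p.1)‖ ^ 2 -
        N / (N + ‖p.2‖) * ‖u p.2‖ ^ 2) + 2 * (N / (N + ‖p.2‖) * ‖u p.2‖ ^ 2 -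
          N / (N + ‖p.2‖) * inner ℝ (u p.2) (u (p.2 + p.1))) := by
    ext p
    rw [norm_sub_sq_real, real_inner_comm]
    ring
  rw [hexp]
  refine ⟨(ha.sub hb).add ((hb.sub hc).const_mul 2), ?_⟩
  rw [integral_add (by exact ha.sub hb) (by exact (hb.sub hc).const_mul 2), integral_const_mul]
  have hbval : ∫ p : Plane × Plane, N / (N + ‖p.2‖) * ‖u p.2‖ ^ 2 ∂(ν.prod volume) =
      V * ∫ x, N / (N + ‖x‖) * ‖u x‖ ^ 2 := by
    rw [integral_prod _ hb]
    simp only [integral_const, hνV, smul_eq_mul]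
  have haval : ∫ p : Plane × Plane, N / (N + ‖p.2‖) * ‖u (p.2 + p.1)‖ ^ 2 ∂(ν.prod volume) ≤
      V * ((∫ x, N / (N + ‖x‖) * ‖u x‖ ^ 2) + r * ∫ x, ‖u x‖ ^ 2 / (N + ‖x‖)) := by
    rw [integral_prod _ ha, ← hνV, ← smul_eq_mul, ← integral_const]
    refine integral_mono_ae ha.integral_prod_left (integrable_const _) ?_
    filter_upwards [ae_restrict_mem measurableSet_ball] with h hh
    rw [mem_ball_zero_iff] at hh
    rw [← integral_sub_right_eq_self _ h, ← integral_const_mul, ← integral_add hg (hE.const_mul r)]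
    refine integral_mono_of_nonneg (Filter.Eventually.of_forall fun x => by positivity)
      (hg.add (hE.const_mul r)) (Filter.Eventually.of_forall fun x => ?_)
    simp only [sub_add_cancel]
    have h1 := weight_le_add hN0 (x := x) (y := x - h) (r := r)
      ((norm_le_norm_sub_add x h).trans (by linarith)) hr.le
    refine (mul_le_mul_of_nonneg_right h1 (sq_nonneg ‖u x‖)).trans (le_of_eq ?_)
    ring
  have hcval : ∫ p : Plane × Plane, (N / (N + ‖p.2‖) * ‖u p.2‖ ^ 2 -
      N / (N + ‖p.2‖) * inner ℝ (u p.2) (u (p.2 + p.1))) ∂(ν.prod volume) =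
      V * ∫ x, N / (N + ‖x‖) * inner ℝ (u x) (v x) := by
    -- Here `h` is integrated first, so that the ball average of `u` appears.
    rw [integral_prod_symm _ (by exact hb.sub hc), ← integral_const_mul]
    refine integral_congr_ae ?_
    filter_upwards [huB, havg] with x hxB hx
    have hxν : Integrable (fun h => u (x + h)) ν := hxB
    have h1 : Integrable (fun h => inner ℝ (u x) (u (x + h))) ν := hxν.const_inner _
    rw [integral_sub (integrable_const _) (h1.const_mul _), integral_const_mul, integral_const_mul, integral_const,
      integral_inner hxν, hx, hνV, inner_smul_right, inner_sub_right, real_inner_self_eq_norm_sq,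
      smul_eq_mul]
    ring
  rw [hcval, integral_sub ha hb, hbval]
  linarith

theorem tendsto_weight (x : Plane) :
    Filter.Tendsto (fun n : ℕ => ((n : ℝ) + 1) / ((n : ℝ) + 1 + ‖x‖)) Filter.atTop (nhds 1) := by
  have h : Filter.Tendsto (fun n : ℕ => (n : ℝ) + 1 + ‖x‖) Filter.atTop Filter.atTop :=
    Filter.tendsto_atTop_add_const_right _ _
      (Filter.tendsto_atTop_add_const_right _ _ tendsto_natCast_atTop_atTop)
  have h1 := (tendsto_const_nhds (x := ‖x‖)).div_atTop h
  have h2 := (tendsto_const_nhds (x := (1 : ℝ))).sub h1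
  rw [sub_zero] at h2
  refine h2.congr fun n => ?_
  have := norm_nonneg x
  field_simp
  ring

/-- Take weights with `N = n + 1`. The right-hand sides converge by dominated convergence, the error
term to zero, and Fatou's lemma handles the left. -/
theorem lintegral_increment_le {u v : Plane → Plane} {r : ℝ} (hr : 0 < r)
    (hum : StronglyMeasurable u)
    (hu : Integrable fun x => ‖u x‖ ^ 2 / (1 + ‖x‖))
    (huB : ∀ᵐ x, IntegrableOn (fun h => u (x + h)) (Metric.ball 0 r))
    (havg : ∀ᵐ x, ∫ h in Metric.ball (0 : Plane) r, u (x + h) =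
      volume.real (Metric.ball (0 : Plane) r) • (u x - v x))
    (huv : Integrable fun x => inner ℝ (u x) (v x)) :
    ∫⁻ h in Metric.ball (0 : Plane) r, ∫⁻ x, ‖u (x + h) - u x‖ₑ ^ 2 ≤
      ENNReal.ofReal (2 * (volume.real (Metric.ball (0 : Plane) r) *
        ∫ x, inner ℝ (u x) (v x))) := by
  have humm : Measurable u := hum.measurable
  set V := volume.real (Metric.ball (0 : Plane) r) with hV
  set ν := volume.restrict (Metric.ball (0 : Plane) r) with hν
  set D : ℕ → Plane × Plane → ℝ := fun n p =>
    ((n : ℝ) + 1) / ((n : ℝ) + 1 + ‖p.2‖) * ‖u (p.2 + p.1) - u p.2‖ ^ 2 with hD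
  set R : ℕ → ℝ := fun n => V * (r * ∫ x, ‖u x‖ ^ 2 / ((n : ℝ) + 1 + ‖x‖)) +
    2 * (V * ∫ x, ((n : ℝ) + 1) / ((n : ℝ) + 1 + ‖x‖) * inner ℝ (u x) (v x)) with hR
  have hbound : ∀ n, ∫⁻ p, ENNReal.ofReal (D n p) ∂(ν.prod volume) ≤ ENNReal.ofReal (R n) := by
    intro n
    obtain ⟨h1, h2⟩ := integral_weight_increment_le (N := (n : ℝ) + 1) hr
      (by linarith [n.cast_nonneg (α := ℝ)]) hum hu huB havg
    rw [← ofReal_integral_eq_lintegral_ofReal h1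
      (Filter.Eventually.of_forall fun p => by simp only [Pi.zero_apply]; positivity)]
    exact ENNReal.ofReal_le_ofReal h2
  have hRlim : Filter.Tendsto R Filter.atTop (nhds (2 * (V * ∫ x, inner ℝ (u x) (v x)))) := by
    have h1 : Filter.Tendsto (fun n : ℕ => ∫ x, ‖u x‖ ^ 2 / ((n : ℝ) + 1 + ‖x‖)) Filter.atTop
        (nhds (∫ _ : Plane, (0 : ℝ))) := by
      refine tendsto_integral_of_dominated_convergence _
        (fun n => Measurable.aestronglyMeasurable (by fun_prop)) hu
        (fun n => Filter.Eventually.of_forall fun x => ?_)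
        (Filter.Eventually.of_forall fun x => ?_)
      · rw [Real.norm_of_nonneg (by positivity)]
        gcongr
        linarith [n.cast_nonneg (α := ℝ)]
      · exact tendsto_const_nhds.div_atTop (Filter.tendsto_atTop_add_const_right _ _
          (Filter.tendsto_atTop_add_const_right _ _ tendsto_natCast_atTop_atTop))
    have h2 : Filter.Tendsto
        (fun n : ℕ => ∫ x, ((n : ℝ) + 1) / ((n : ℝ) + 1 + ‖x‖) * inner ℝ (u x) (v x))
        Filter.atTop (nhds (∫ x, inner ℝ (u x) (v x))) := by
      refine tendsto_integral_of_dominated_convergence _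
        (fun n => AEStronglyMeasurable.mul (Measurable.aestronglyMeasurable (by fun_prop))
          huv.1) huv.norm
        (fun n => Filter.Eventually.of_forall fun x => ?_)
        (Filter.Eventually.of_forall fun x => ?_)
      · rw [norm_mul]
        refine mul_le_of_le_one_left (norm_nonneg _) ?_
        rw [Real.norm_of_nonneg (by positivity), div_le_one (by positivity)]
        linarith [norm_nonneg x]
      · simpa using (tendsto_weight x).mul_const (inner ℝ (u x) (v x))
    rw [integral_zero] at h1
    simpa using ((h1.const_mul r).const_mul V).add ((h2.const_mul V).const_mul 2)
  have hDlim : ∀ p, Filter.Tendsto (fun n => ENNReal.ofReal (D n p)) Filter.atTop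
      (nhds (‖u (p.2 + p.1) - u p.2‖ₑ ^ 2)) := by
    intro p
    rw [← ofReal_norm, ← ENNReal.ofReal_pow (norm_nonneg _)]
    refine ENNReal.tendsto_ofReal ?_
    simpa using (tendsto_weight p.2).mul_const (‖u (p.2 + p.1) - u p.2‖ ^ 2)
  have hprod : ∫⁻ h, ∫⁻ x, ‖u (x + h) - u x‖ₑ ^ 2 ∂volume ∂ν =
      ∫⁻ p : Plane × Plane, ‖u (p.2 + p.1) - u p.2‖ₑ ^ 2 ∂(ν.prod volume) := by
    rw [lintegral_prod _ (by fun_prop)]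
  rw [hprod]
  calc
    _ = ∫⁻ p, Filter.liminf (fun n => ENNReal.ofReal (D n p)) Filter.atTop ∂(ν.prod volume) :=
      lintegral_congr fun p => ((hDlim p).liminf_eq).symm
    _ ≤ Filter.liminf (fun n => ∫⁻ p, ENNReal.ofReal (D n p) ∂(ν.prod volume)) Filter.atTop :=
      lintegral_liminf_le fun n => by simp only [hD]; fun_prop
    _ ≤ Filter.liminf (fun n => ENNReal.ofReal (R n)) Filter.atTop :=
      Filter.liminf_le_liminf (Filter.Eventually.of_forall hbound)
    _ = _ := (ENNReal.tendsto_ofReal hRlim).liminf_eq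

/-! ### The bound for densities, and reduction of signed measures to it. -/

theorem structureFunctionSq_velocity_le {μ : Measure Plane} [IsFiniteMeasure μ] {σ : Plane → ℝ}
    (hσm : Measurable σ) (hσ : ∀ y, |σ y| ≤ 1) {C β r : ℝ} (hr : 0 < r) (hβ : 0 < β)
    (hμ : ∀ x s, 0 < s → s ≤ r → μ (Metric.closedBall x s) ≤ ENNReal.ofReal (C * s ^ β)) :
    structureFunctionSq (velocity μ σ) r ≤
      ENNReal.ofReal (C / β) * μ Set.univ * ENNReal.ofReal (r ^ β) := by
  have havg : ∀ᵐ x, ∫ h in Metric.ball (0 : Plane) r, velocity μ σ (x + h) =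
      volume.real (Metric.ball (0 : Plane) r) • (velocity μ σ x - localVelocity μ σ r x) := by
    filter_upwards [ae_inversePotential_ne_top (μ := μ)] with x hx
    exact setIntegral_ball_velocity hσm hσ hr hx
  have h1 := lintegral_increment_le hr (stronglyMeasurable_velocity hσm)
    (integrable_norm_velocity_sq_div hσm hσ hr hβ hμ)
    (Filter.Eventually.of_forall (integrableOn_ball_velocity hσm hσ r)) havg
    (integrable_inner_velocity_localVelocity hσm hσ hr hβ hμ)
  have h2 := enorm_integral_inner_velocity_localVelocity_le hσm hσ hr hβ hμ
  set I := ∫ x, inner ℝ (velocity μ σ x) (localVelocity μ σ r x)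
  have hV0 : volume (Metric.ball (0 : Plane) r) ≠ 0 := (Metric.measure_ball_pos _ _ hr).ne'
  have hVt : volume (Metric.ball (0 : Plane) r) ≠ ⊤ := measure_ball_lt_top.ne
  have hC : ENNReal.ofReal (C / β) * ENNReal.ofReal (r ^ β) =
      ENNReal.ofReal C * ENNReal.ofReal (r ^ β / β) := by
    rw [← ENNReal.ofReal_mul' (by positivity), ← ENNReal.ofReal_mul' (by positivity)]
    congr 1
    ring
  calc
    _ ≤ (volume (Metric.ball (0 : Plane) r))⁻¹ *
        (volume (Metric.ball (0 : Plane) r) * (ENNReal.ofReal 2 * ‖I‖ₑ)) := by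
      rw [structureFunctionSq]
      gcongr
      refine h1.trans ?_
      rw [mul_left_comm, ENNReal.ofReal_mul measureReal_nonneg, ofReal_measureReal hVt,
        ENNReal.ofReal_mul (by norm_num)]
      gcongr
      exact Real.ofReal_le_enorm I
    _ = ENNReal.ofReal 2 * ‖I‖ₑ := ENNReal.inv_mul_cancel_left hV0 hVt
    _ ≤ ENNReal.ofReal 2 * (ENNReal.ofReal (1 / (2 * Real.pi)) *
        (ENNReal.ofReal C * ENNReal.ofReal (r ^ β / β)) * μ Set.univ) := by gcongr
    _ = ENNReal.ofReal (1 / Real.pi) * ((ENNReal.ofReal C * ENNReal.ofReal (r ^ β / β)) *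
        μ Set.univ) := by
      rw [← mul_assoc, ← mul_assoc, ← ENNReal.ofReal_mul (by norm_num), mul_assoc]
      congr 2
      field_simp
    -- The sharper factor `1/π`, from `2 · (2π)⁻¹`, is discarded.
    _ ≤ (ENNReal.ofReal C * ENNReal.ofReal (r ^ β / β)) * μ Set.univ := by
      refine mul_le_of_le_one_left' ?_
      rw [ENNReal.ofReal_le_one, div_le_one Real.pi_pos]
      linarith [Real.pi_gt_three]
    _ = _ := by rw [← hC]; ring

theorem structureFunctionSq_congr_ae {u v : Plane → Plane} (huv : u =ᵐ[volume] v) (r : ℝ) :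
    structureFunctionSq u r = structureFunctionSq v r := by
  rw [structureFunctionSq, structureFunctionSq]
  congr 1
  refine lintegral_congr fun h => lintegral_congr_ae ?_
  filter_upwards [huv, (measurePreserving_add_right volume h).quasiMeasurePreserving.ae huv]
    with x hx hxh
  rw [hx, hxh]

theorem isFiniteMeasure_variation (ω : SignedMeasure Plane) : IsFiniteMeasure ω.variation := by
  rw [← ω.totalVariation_eq_variation]
  infer_instance

/-- The polar decomposition of a signed measure: `ω` has a density `σ` of modulus at most `1`
with respect to its variation. -/
theorem exists_sign_density (ω : SignedMeasure Plane) :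
    ∃ σ : Plane → ℝ, Measurable σ ∧ (∀ y, |σ y| ≤ 1) ∧
      ∀ f : Plane → Plane, ω.Integrable f → ∫ᵛ y, f y ∂<•ω = ∫ y, σ y • f y ∂ω.variation := by
  obtain ⟨s, hs, hpos, hneg⟩ := ω.toJordanDecomposition.mutuallySingular
  set P := ω.toJordanDecomposition.posPart
  set Q := ω.toJordanDecomposition.negPart
  have hvar : ω.variation = P + Q := ω.totalVariation_eq_variation.symm
  have hω : ω = P.toSignedMeasure - Q.toSignedMeasure :=
    (ω.toSignedMeasure_toJordanDecomposition).symm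
  -- This is `1` on `sᶜ`, which carries the positive part, and `-1` on `s`, which carries the
  -- negative part.
  set σ : Plane → ℝ := fun y => sᶜ.indicator (fun _ => 2) y - 1 with hσ
  refine ⟨σ, (measurable_const.indicator hs.compl).sub_const 1, fun y => ?_, fun f hf => ?_⟩
  · by_cases hy : y ∈ s
    · simp [hσ, hy]
    · simp only [hσ, Set.indicator_of_mem (Set.mem_compl hy)]
      norm_num
  · have hfPQ : Integrable f (P + Q) := hvar ▸ hf
    have hfP : Integrable f P := hfPQ.left_of_add_measure
    have hfQ : Integrable f Q := hfPQ.right_of_add_measure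
    have hP : (fun y => σ y • f y) =ᵐ[P] f := by
      have : ∀ᵐ y ∂P, y ∉ s := measure_eq_zero_iff_ae_notMem.1 hpos
      filter_upwards [this] with y hy
      simp only [hσ, Set.indicator_of_mem (Set.mem_compl hy)]
      norm_num
    have hQ : (fun y => σ y • f y) =ᵐ[Q] fun y => -f y := by
      have : ∀ᵐ y ∂Q, y ∉ sᶜ := measure_eq_zero_iff_ae_notMem.1 hneg
      filter_upwards [this] with y hy
      simp [hσ, Set.indicator_of_notMem hy]
    rw [hvar, integral_add_measure (hfP.congr hP.symm) (hfQ.neg.congr hQ.symm),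
      integral_congr_ae hP, integral_congr_ae hQ, integral_neg]
    conv_lhs => rw [hω]
    rw [VectorMeasure.integral_sub_vectorMeasure
      (by simpa [VectorMeasure.Integrable] using hfP)
      (by simpa [VectorMeasure.Integrable] using hfQ),
      VectorMeasure.integral_toSignedMeasure, VectorMeasure.integral_toSignedMeasure,
      sub_eq_add_neg]

theorem ae_integrable_biotSavartKernel (ω : SignedMeasure Plane) :
    ∀ᵐ x : Plane, ω.Integrable fun y => biotSavartKernel (x - y) := by
  have := isFiniteMeasure_variation ω
  filter_upwards [ae_inversePotential_ne_top (μ := ω.variation)] with x hx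
  simpa using integrable_smul_biotSavartKernel (σ := fun _ => 1) measurable_const (by simp) hx

end VortexSheet

end

theorem corollary2p2
    (ω : MeasureTheory.SignedMeasure VortexSheet.Plane)
    (hω : VortexSheet.MemHNegOneLoc ω)
    (u : VortexSheet.Plane → VortexSheet.Plane)
    (hu : ∀ᵐ x, u x = VortexSheet.biotSavart ω x)
    (C β : ℝ) (hβ : 0 < β) :
    (∀ᵐ x : VortexSheet.Plane, ω.Integrable (fun y => VortexSheet.biotSavartKernel (x - y))) ∧
    ∀ r : ℝ, 0 < r →
      (∀ s : ℝ, 0 < s → s ≤ r →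
        VortexSheet.vorticityMaximal ω s ≤ ENNReal.ofReal (C * s ^ β)) →
      VortexSheet.structureFunctionSq u r ≤
        ENNReal.ofReal (C / β) * VortexSheet.totalVariationNorm ω * ENNReal.ofReal (r ^ β) := by
  refine ⟨VortexSheet.ae_integrable_biotSavartKernel ω, fun r hr hM => ?_⟩
  have := VortexSheet.isFiniteMeasure_variation ω
  obtain ⟨σ, hσm, hσ, hσω⟩ := VortexSheet.exists_sign_density ω
  have huv : u =ᵐ[volume] VortexSheet.velocity ω.variation σ := by
    filter_upwards [hu, VortexSheet.ae_integrable_biotSavartKernel ω] with x hx hxi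
    rw [hx, VortexSheet.biotSavart, hσω _ hxi, VortexSheet.velocity]
  rw [VortexSheet.structureFunctionSq_congr_ae huv]
  refine VortexSheet.structureFunctionSq_velocity_le hσm hσ hr hβ fun x s hs hsr => ?_
  exact (le_iSup (fun x => ω.variation (Metric.closedBall x s)) x).trans (hM s hs hsr)
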